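/- Perfect Matching Cut is polynomial-time solvable for graphs of radius at most $2$. In detail: all graphs are finite and simple. The radius of a connected graph $G=(V,E)$ is $\min_{u\in V}\max_{v\in V}\mathrm{dist}_G(u,v)$; graphs of radius at most $2$ are understood to be connected and non-empty. A set $M\subseteq E$ is a perfect matching cut of $G$ if $M$ is a perfect matching of $G$ (every vertex is incident to exactly one edge of $M$) and $V$ can be partitioned into two non-empty sets $B$ and $R$ such that $M$ is the set of all edges of $G$ with one end-vertex in $B$ and the other in $R$. Then there are an algorithm (a program for a random access machine whose arithmetic operations are addition and truncated subtraction, each elementary operation counting as one step) and a polynomial $f$ such that, for every $n$ and every graph $G$ on $n$ vertices of radius at most $2$, the algorithm, given the adjacency matrix of $G$, halts after at most $f(n)$ steps and correctly decides whether $G$ has a perfect matching cut. -/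

import Mathlib

namespace PMC

/-! ### Perfect matching cuts -/

/-- `M` is an edge cut of `G`: the vertex set can be partitioned into two (non-empty) sets `B` and
`R` such that `M` consists of all the edges of `G` with one end-vertex in `B` and the other one
in `R`. -/
def IsEdgeCut {V : Type*} (G : SimpleGraph V) (M : Set (Sym2 V)) : Prop :=
  ∃ B R : Set V, B.Nonempty ∧ R.Nonempty ∧ Disjoint B R ∧ B ∪ R = Set.univ ∧
    M = {e | e ∈ G.edgeSet ∧ ∃ u ∈ B, ∃ v ∈ R, e = s(u, v)}

/-- `G` has a perfect matching cut: an edge cut that is a perfect matching of `G`. -/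
def HasPerfectMatchingCut {V : Type*} (G : SimpleGraph V) : Prop :=
  ∃ M : G.Subgraph, M.IsPerfectMatching ∧ IsEdgeCut G M.edgeSet

/-! ### A random access machine with a step count

The memory consists of arrays of natural numbers, indexed by the natural numbers; array names are
constants of the program, so that a program uses finitely many arrays, while the position in an
array may be computed (indirect addressing). The arithmetic instructions are addition and truncated
subtraction only; there is no multiplication, so that numbers of `t` bits cannot be created in
fewer than about `t` steps and counting steps at unit cost is polynomially equivalent to counting
the steps of a Turing machine. -/

namespace RAM

/-- The memory: cell `i` of array `a` holds the number `s a i`. -/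
abbrev Memory : Type := ℕ → ℕ → ℕ

/-- Write `v` into cell `i` of array `a`. -/
def Memory.write (s : Memory) (a i v : ℕ) : Memory :=
  Function.update s a (Function.update (s a) i v)

/-- Arithmetic expressions. -/
inductive Expr : Type
  /-- a constant -/
  | const (c : ℕ) : Expr
  /-- the contents of the cell of array `a` whose index is the value of `i` -/
  | read (a : ℕ) (i : Expr) : Expr
  /-- addition -/
  | add (e₁ e₂ : Expr) : Expr
  /-- subtraction, truncated at `0` -/
  | sub (e₁ e₂ : Expr) : Expr

/-- The value of an expression in a memory. -/
def Expr.eval (s : Memory) : Expr → ℕ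
  | .const c => c
  | .read a i => s a (i.eval s)
  | .add e₁ e₂ => e₁.eval s + e₂.eval s
  | .sub e₁ e₂ => e₁.eval s - e₂.eval s

/-- The number of elementary steps needed to evaluate an expression: one for every operation,
memory access and constant. -/
def Expr.cost : Expr → ℕ
  | .const _ => 1
  | .read _ i => i.cost + 1
  | .add e₁ e₂ => e₁.cost + e₂.cost + 1
  | .sub e₁ e₂ => e₁.cost + e₂.cost + 1

/-- Programs. -/
inductive Program : Type
  /-- do nothing -/
  | skip : Program
  /-- write the value of `e` into the cell of array `a` whose index is the value of `i` -/
  | write (a : ℕ) (i e : Expr) : Program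
  /-- run `p`, then run `q` -/
  | seq (p q : Program) : Program
  /-- run `p` if the value of `e` is not `0`, otherwise run `q` -/
  | cond (e : Expr) (p q : Program) : Program
  /-- run `p` again and again, as long as the value of `e` is not `0` -/
  | loop (e : Expr) (p : Program) : Program

/-- `Exec p s t s'`: the program `p`, started in memory `s`, halts after exactly `t` steps, in
memory `s'`. -/
inductive Exec : Program → Memory → ℕ → Memory → Prop
  | skip (s : Memory) : Exec .skip s 1 s
  | write (a : ℕ) (i e : Expr) (s : Memory) :
      Exec (.write a i e) s (i.cost + e.cost + 1) (s.write a (i.eval s) (e.eval s))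
  | seq {p q : Program} {s s' s'' : Memory} {t t' : ℕ} :
      Exec p s t s' → Exec q s' t' s'' → Exec (.seq p q) s (t + t') s''
  | cond_true {e : Expr} {p q : Program} {s s' : Memory} {t : ℕ} :
      e.eval s ≠ 0 → Exec p s t s' → Exec (.cond e p q) s (e.cost + 1 + t) s'
  | cond_false {e : Expr} {p q : Program} {s s' : Memory} {t : ℕ} :
      e.eval s = 0 → Exec q s t s' → Exec (.cond e p q) s (e.cost + 1 + t) s'
  | loop_true {e : Expr} {p : Program} {s s' s'' : Memory} {t t' : ℕ} :
      e.eval s ≠ 0 → Exec p s t s' → Exec (.loop e p) s' t' s'' →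
        Exec (.loop e p) s (e.cost + 1 + t + t') s''
  | loop_false {e : Expr} {p : Program} {s : Memory} :
      e.eval s = 0 → Exec (.loop e p) s (e.cost + 1) s

/-- Programs are deterministic: the running time and the final memory are determined by the program
and the initial memory. -/
theorem Exec.deterministic {p : Program} {s s₁ : Memory} {t₁ : ℕ} (h₁ : Exec p s t₁ s₁) :
    ∀ {t₂ : ℕ} {s₂ : Memory}, Exec p s t₂ s₂ → t₁ = t₂ ∧ s₁ = s₂ := by
  induction h₁ with
  | skip s => intro _ _ h; cases h; exact ⟨rfl, rfl⟩
  | write a i e s => intro _ _ h; cases h; exact ⟨rfl, rfl⟩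
  | seq _ _ ih₁ ih₂ =>
    intro _ _ h
    cases h with
    | seq h₁ h₂ =>
      obtain ⟨rfl, rfl⟩ := ih₁ h₁
      obtain ⟨rfl, rfl⟩ := ih₂ h₂
      exact ⟨rfl, rfl⟩
  | cond_true hb _ ih =>
    intro _ _ h
    cases h with
    | cond_true _ h₁ => obtain ⟨rfl, rfl⟩ := ih h₁; exact ⟨rfl, rfl⟩
    | cond_false hb' _ => exact absurd hb' hb
  | cond_false hb _ ih =>
    intro _ _ h
    cases h with
    | cond_true hb' _ => exact absurd hb hb'
    | cond_false _ h₁ => obtain ⟨rfl, rfl⟩ := ih h₁; exact ⟨rfl, rfl⟩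
  | loop_true hb _ _ ih₁ ih₂ =>
    intro _ _ h
    cases h with
    | loop_true _ h₁ h₂ =>
      obtain ⟨rfl, rfl⟩ := ih₁ h₁
      obtain ⟨rfl, rfl⟩ := ih₂ h₂
      exact ⟨rfl, rfl⟩
    | loop_false hb' => exact absurd hb' hb
  | loop_false hb =>
    intro _ _ h
    cases h with
    | loop_true hb' _ _ => exact absurd hb hb'
    | loop_false _ => exact ⟨rfl, rfl⟩

open Classical in
/-- The memory that holds the input graph `G` on the vertices `0, …, n - 1`: cell `0` of array `0`
holds `n`; array `1` holds the adjacency matrix of `G`, row by row (its cell `i * n + j` holds `1`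
if `i` and `j` are adjacent and `0` otherwise); all other cells hold `0`. -/
noncomputable def input {n : ℕ} (G : SimpleGraph (Fin n)) : Memory := fun a k =>
  if a = 0 then (if k = 0 then n else 0)
  else if a = 1 then
    (if ∃ i j : Fin n, k = (i : ℕ) * n + (j : ℕ) ∧ G.Adj i j then 1 else 0)
  else 0

end RAM

/-- The decision problem `Q` on finite graphs is polynomial-time solvable on the graphs in the
class `C`: there are a program and a polynomial `f` such that on every graph of `C` with `n`
vertices the program halts after at most `f n` steps, with the correct answer (`1` for yes and `0`
for no) in cell `0` of array `0`. -/
def PolyTimeSolvableOn (Q C : ∀ n : ℕ, SimpleGraph (Fin n) → Prop) : Prop :=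
  ∃ (p : RAM.Program) (f : Polynomial ℕ), ∀ (n : ℕ) (G : SimpleGraph (Fin n)), C n G →
    ∃ (t : ℕ) (s : RAM.Memory), RAM.Exec p (RAM.input G) t s ∧ t ≤ f.eval n ∧
      (Q n G → s 0 0 = 1) ∧ (¬ Q n G → s 0 0 = 0)

end PMC

namespace PMC

namespace RAM

/-! ### A structured language that compiles to the random access machine -/

/-! A perfect matching cut is a 2-colouring in which every vertex has exactly one neighbour of the
other colour, its partner. Let r be a centre of G, say of colour `false`, and b its partner. Then
all neighbours of r except b are `false`, all neighbours of b except r are `true`, and radius at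
most 2 gives every remaining vertex a precoloured `false` neighbour. Adjacent uncoloured vertices
therefore agree: otherwise the `true` one would have two `false` neighbours. So the partner of an
uncoloured vertex is always precoloured.

Given r and b, almost all requirements now concern at most two vertices at a time (`Conflict`),
which is 2-SAT. The exception is that every precoloured vertex needs at least one opposite
neighbour. Counting replaces it: partners map the uncoloured vertices injectively into the
precoloured vertices without an opposite precoloured neighbour, and this map is onto exactly when
the two sets have equal size (`Balanced`). The algorithm tries all pairs r, b. A solution for any
pair yields a cut (`isCutColoring_of_respectsConflicts`); the radius matters only for the converse
(`exists_isCutColoring_iff`). 2-SAT is decided by the transitive closure of the implication relation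
(`close_spec`, `exists_assignment`).

For the step count, the algorithm is written with bounded sums and bounded loops whose bounds lie in
array `0`. Statements never write there, so a fixed nesting of loops runs in polynomial time
(`Term.exists_program`, `Stmt.exists_program`). -/

theorem Memory.write_apply (s : Memory) (a i v b j : ℕ) :
    s.write a i v b j = if b = a ∧ j = i then v else s b j := by
  by_cases hb : b = a
  · subst hb
    by_cases hj : j = i <;> simp [Memory.write, hj]
  · simp [Memory.write, hb]

theorem Memory.write_of_ne (s : Memory) {a b : ℕ} (i v : ℕ) (h : b ≠ a) :
    s.write a i v b = s b := by
  simp [Memory.write, h]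

/-- Numerical terms. Array `2` holds the variables and array `3` is reserved for intermediate
results of the compiled programs. -/
inductive Term : Type
  /-- a constant -/
  | const (c : ℕ) : Term
  /-- the contents of a cell of array `a` -/
  | read (a : ℕ) (ha : a ≠ 3) (i : Term) : Term
  /-- addition -/
  | add (t u : Term) : Term
  /-- truncated subtraction -/
  | sub (t u : Term) : Term
  /-- the sum of `t` over all values of the variable `x` below the contents of cell `c` of
  array `0` -/
  | sum (c x : ℕ) (t : Term) : Term

/-- The value of a term in a memory. -/
def Term.eval : Term → Memory → ℕ
  | .const c, _ => c
  | .read a _ i, s => s a (i.eval s)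
  | .add t u, s => t.eval s + u.eval s
  | .sub t u, s => t.eval s - u.eval s
  | .sum c x t, s => ∑ k ∈ Finset.range (s 0 c), t.eval (s.write 2 x k)

/-- Statements: assignments to arrays other than the reserved ones, and bounded iteration. -/
inductive Stmt : Type
  /-- write the value of `t` into the cell of array `a` whose index is the value of `i` -/
  | assign (a : ℕ) (ha : 3 < a) (i t : Term) : Stmt
  /-- run two statements one after the other -/
  | seq (p q : Stmt) : Stmt
  /-- run `p` for all values of the variable `x` below the contents of cell `c` of array `0` -/
  | forRange (c x : ℕ) (p : Stmt) : Stmt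

/-- The first `n` rounds of an iteration. -/
def iterateVar (F : Memory → Memory) (x : ℕ) (s : Memory) : ℕ → Memory
  | 0 => s
  | n + 1 => F ((iterateVar F x s n).write 2 x n)

/-- The memory after running a statement. -/
def Stmt.run : Stmt → Memory → Memory
  | .assign a _ i t, s => s.write a (i.eval s) (t.eval s)
  | .seq p q, s => q.run (p.run s)
  | .forRange c x p, s => iterateVar p.run x s (s 0 c)

/-- The memories agree outside of the scratch array, and in the first `d` cells of that array. -/
def AgreeTo (d : ℕ) (s s' : Memory) : Prop :=
  (∀ a, a ≠ 3 → s' a = s a) ∧ ∀ j, j < d → s' 3 j = s 3 j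

theorem AgreeTo.refl (d : ℕ) (s : Memory) : AgreeTo d s s := ⟨fun _ _ => rfl, fun _ _ => rfl⟩

theorem AgreeTo.trans {d : ℕ} {s s' s'' : Memory} (h : AgreeTo d s s') (h' : AgreeTo d s' s'') :
    AgreeTo d s s'' :=
  ⟨fun a ha => (h'.1 a ha).trans (h.1 a ha), fun j hj => (h'.2 j hj).trans (h.2 j hj)⟩

theorem AgreeTo.mono {d e : ℕ} {s s' : Memory} (h : AgreeTo e s s') (hd : d ≤ e) :
    AgreeTo d s s' :=
  ⟨h.1, fun j hj => h.2 j (hj.trans_le hd)⟩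

theorem AgreeTo.write_scratch {d : ℕ} {s s' : Memory} (h : AgreeTo d s s') {e : ℕ} (he : d ≤ e)
    (v : ℕ) : AgreeTo d s (s'.write 3 e v) := by
  refine ⟨fun a ha => by rw [Memory.write_of_ne _ _ _ ha, h.1 a ha], fun j hj => ?_⟩
  rw [Memory.write_apply, if_neg (by omega), h.2 j hj]

theorem AgreeTo.write {d : ℕ} {s s' : Memory} (h : AgreeTo d s s') (a i v : ℕ) :
    AgreeTo d (s.write a i v) (s'.write a i v) := by
  refine ⟨fun b hb => funext fun j => ?_, fun j hj => ?_⟩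
  · rw [Memory.write_apply, Memory.write_apply, h.1 b hb]
  · rw [Memory.write_apply, Memory.write_apply, h.2 j hj]

/-- Terms cannot read array `3`, so compiled code may use it freely without changing their values.
-/
theorem Term.eval_congr (t : Term) {s s' : Memory} (h : AgreeTo 0 s s') :
    t.eval s' = t.eval s := by
  induction t generalizing s s' with
  | const c => rfl
  | read a ha i ih => simp only [Term.eval, ih h, h.1 a ha]
  | add t u iht ihu => simp only [Term.eval, iht h, ihu h]
  | sub t u iht ihu => simp only [Term.eval, iht h, ihu h]
  | sum c x t ih =>
    simp only [Term.eval, h.1 0 (by decide)]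
    exact Finset.sum_congr rfl fun k _ => ih (h.write 2 _ _)

/-! ### Counting loops and compilation with polynomial time bounds -/

/-- The running time of a loop that counts upwards. -/
theorem exec_loop {e : Expr} {p : Program} {n T : ℕ} (I : ℕ → Memory → Prop)
    (hcond : ∀ k s, k ≤ n → I k s → (e.eval s ≠ 0 ↔ k < n))
    (hbody : ∀ k s, k < n → I k s → ∃ t s', Exec p s t s' ∧ t ≤ T ∧ I (k + 1) s')
    {s : Memory} (h0 : I 0 s) :
    ∃ t s', Exec (.loop e p) s t s' ∧ t ≤ (n + 1) * (T + e.cost + 1) ∧ I n s' := by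
  suffices H : ∀ m k s, k + m = n → I k s →
      ∃ t s', Exec (.loop e p) s t s' ∧ t ≤ (m + 1) * (T + e.cost + 1) ∧ I n s' from
    H n 0 s (by omega) h0
  intro m
  induction m with
  | zero =>
    intro k s hk hI
    obtain rfl : k = n := by omega
    refine ⟨_, s, .loop_false ?_, by omega, hI⟩
    by_contra hne
    exact lt_irrefl _ ((hcond k s le_rfl hI).1 hne)
  | succ m ih =>
    intro k s hk hI
    obtain ⟨t, s', hx, ht, hI'⟩ := hbody k s (by omega) hI
    obtain ⟨t', s'', hx', ht', hI''⟩ := ih (k + 1) s' (by omega) hI'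
    refine ⟨_, s'', .loop_true ((hcond k s (by omega) hI).2 (by omega)) hx hx', ?_, hI''⟩
    calc e.cost + 1 + t + t' ≤ e.cost + 1 + T + (m + 1) * (T + e.cost + 1) := by omega
      _ = (m + 1 + 1) * (T + e.cost + 1) := by ring

/-- A loop over all `k` below the contents of cell `c` of array `0`, with its counter in the scratch
cell `d`. -/
def countingLoop (c d : ℕ) (p : Program) : Program :=
  .seq (.write 3 (.const d) (.const 0))
    (.loop (.sub (.read 0 (.const c)) (.read 3 (.const d)))
      (.seq p (.write 3 (.const d) (.add (.read 3 (.const d)) (.const 1)))))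

theorem exec_countingLoop {c d n T : ℕ} {p : Program} (I : ℕ → Memory → Prop)
    (hI : ∀ k s, I k s → s 0 c = n)
    (hwrite : ∀ k s v, I k s → I k (s.write 3 d v))
    (hbody : ∀ k s, k < n → I k s → s 3 d = k →
      ∃ t s', Exec p s t s' ∧ t ≤ T ∧ I (k + 1) s' ∧ s' 3 d = k)
    {s : Memory} (h0 : I 0 s) :
    ∃ t s', Exec (countingLoop c d p) s t s' ∧ t ≤ (n + 1) * (T + 12) + 3 ∧ I n s' := by
  obtain ⟨t, s', hx, ht, hI', -⟩ := exec_loop (n := n) (T := T + 6)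
    (e := .sub (.read 0 (.const c)) (.read 3 (.const d)))
    (p := .seq p (.write 3 (.const d) (.add (.read 3 (.const d)) (.const 1))))
    (fun k s => I k s ∧ s 3 d = k)
    (by
      rintro k s - ⟨h, hk⟩
      simp only [Expr.eval, hI k s h, hk]
      omega)
    (by
      rintro k s hk ⟨h, hd⟩
      obtain ⟨t, s', hx, ht, h', hd'⟩ := hbody k s hk h hd
      refine ⟨_, _, .seq hx (.write _ _ _ _), ?_, hwrite _ _ _ h', ?_⟩
      · simp only [Expr.cost]
        omega
      · simp [Memory.write_apply, Expr.eval, hd'])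
    (s := s.write 3 d 0) ⟨hwrite _ _ _ h0, by simp [Memory.write_apply]⟩
  refine ⟨_, s', .seq (.write _ _ _ _) hx, ?_, hI'⟩
  simp only [Expr.cost] at ht ⊢
  calc 1 + 1 + 1 + t ≤ 3 + (n + 1) * (T + 6 + (1 + 1 + (1 + 1) + 1) + 1) := by omega
    _ = _ := by ring

/-- Terms can be evaluated in time polynomial in the numbers in array `0`. -/
theorem Term.exists_program (t : Term) (d : ℕ) :
    ∃ (p : Program) (f : Polynomial ℕ), ∀ (s : Memory) (N : ℕ), (∀ c, s 0 c ≤ N) →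
      ∃ τ s', Exec p s τ s' ∧ τ ≤ f.eval N ∧ AgreeTo d s s' ∧ s' 3 d = t.eval s := by
  induction t generalizing d with
  | const c =>
    refine ⟨.write 3 (.const d) (.const c), 3, fun s N _ => ⟨_, _, .write _ _ _ _, ?_, ?_, ?_⟩⟩
    · simp [Expr.cost]
    · exact (AgreeTo.refl d s).write_scratch le_rfl _
    · simp [Memory.write_apply, Expr.eval, Term.eval]
  | read a ha i ih =>
    obtain ⟨p, f, hp⟩ := ih d
    refine ⟨.seq p (.write 3 (.const d) (.read a (.read 3 (.const d)))), f + 5, fun s N hN => ?_⟩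
    obtain ⟨τ, s', hx, hτ, hs, hv⟩ := hp s N hN
    refine ⟨_, _, .seq hx (.write _ _ _ _), ?_, hs.write_scratch le_rfl _, ?_⟩
    · simp only [Expr.cost, Polynomial.eval_add, Polynomial.eval_ofNat]
      omega
    · simp [Memory.write_apply, Expr.eval, Term.eval, hv, hs.1 a ha]
  | add t u iht ihu =>
    obtain ⟨p, f, hp⟩ := iht d
    -- Scratch cells are used as a stack: the first value stays in cell `d`, which the code for the
    -- second must preserve.
    obtain ⟨q, g, hq⟩ := ihu (d + 1)
    refine ⟨.seq p (.seq q (.write 3 (.const d)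
      (.add (.read 3 (.const d)) (.read 3 (.const (d + 1)))))), f + (g + 7), fun s N hN => ?_⟩
    obtain ⟨τ, s', hx, hτ, hs, hv⟩ := hp s N hN
    obtain ⟨τ', s'', hx', hτ', hs', hv'⟩ := hq s' N (by rwa [hs.1 0 (by decide)])
    refine ⟨_, _, .seq hx (.seq hx' (.write _ _ _ _)), ?_,
      (hs.trans (hs'.mono (Nat.le_succ d))).write_scratch le_rfl _, ?_⟩
    · simp only [Expr.cost, Polynomial.eval_add, Polynomial.eval_ofNat]
      omega
    · simp [Memory.write_apply, Expr.eval, Term.eval, hv', hs'.2 d (Nat.lt_succ_self d), hv,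
        u.eval_congr (hs.mono (Nat.zero_le d))]
  | sub t u iht ihu =>
    obtain ⟨p, f, hp⟩ := iht d
    obtain ⟨q, g, hq⟩ := ihu (d + 1)
    refine ⟨.seq p (.seq q (.write 3 (.const d)
      (.sub (.read 3 (.const d)) (.read 3 (.const (d + 1)))))), f + (g + 7), fun s N hN => ?_⟩
    obtain ⟨τ, s', hx, hτ, hs, hv⟩ := hp s N hN
    obtain ⟨τ', s'', hx', hτ', hs', hv'⟩ := hq s' N (by rwa [hs.1 0 (by decide)])
    refine ⟨_, _, .seq hx (.seq hx' (.write _ _ _ _)), ?_,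
      (hs.trans (hs'.mono (Nat.le_succ d))).write_scratch le_rfl _, ?_⟩
    · simp only [Expr.cost, Polynomial.eval_add, Polynomial.eval_ofNat]
      omega
    · simp [Memory.write_apply, Expr.eval, Term.eval, hv', hs'.2 d (Nat.lt_succ_self d), hv,
        u.eval_congr (hs.mono (Nat.zero_le d))]
  | sum c x t ih =>
    obtain ⟨p, f, hp⟩ := ih (d + 3)
    -- scratch cells: `d` accumulates, `d + 1` counts, `d + 2` saves the variable
    refine ⟨.seq (.write 3 (.const (d + 2)) (.read 2 (.const x)))
      (.seq (.write 3 (.const d) (.const 0))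
        (.seq (countingLoop c (d + 1) (.seq (.write 2 (.const x) (.read 3 (.const (d + 1))))
          (.seq p (.write 3 (.const d) (.add (.read 3 (.const d)) (.read 3 (.const (d + 3))))))))
          (.write 2 (.const x) (.read 3 (.const (d + 2)))))),
      (Polynomial.X + 1) * (f + 23) + 14, fun s N hN => ?_⟩
    obtain ⟨τ, s', hx, hτ, hs, hd2, hacc⟩ := exec_countingLoop (c := c) (d := d + 1) (n := s 0 c)
      (T := f.eval N + 11)
      (p := .seq (.write 2 (.const x) (.read 3 (.const (d + 1))))
          (.seq p (.write 3 (.const d) (.add (.read 3 (.const d)) (.read 3 (.const (d + 3)))))))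
      -- The loop overwrites variable `x`, so agreement with `s` is claimed only once its saved
      -- value is put back.
      (fun k s' => AgreeTo d s (s'.write 2 x (s 2 x)) ∧ s' 3 (d + 2) = s 2 x ∧
        s' 3 d = ∑ k ∈ Finset.range k, t.eval (s.write 2 x k))
      (by
        rintro k s' ⟨h, -, -⟩
        have := h.1 0 (by decide)
        rw [Memory.write_of_ne _ _ _ (by decide)] at this
        rw [this])
      (by
        rintro k s' v ⟨h, h2, h3⟩
        refine ⟨?_, ?_, ?_⟩
        · have : (s'.write 3 (d + 1) v).write 2 x (s 2 x)
              = (s'.write 2 x (s 2 x)).write 3 (d + 1) v := by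
            funext a j
            simp only [Memory.write_apply]
            split_ifs <;> omega
          rw [this]
          exact h.write_scratch (Nat.le_succ d) _
        · simpa [Memory.write_apply] using h2
        · simpa [Memory.write_apply] using h3)
      (by
        rintro k s' hk ⟨h, h2, h3⟩ hd
        have hag : AgreeTo d (s.write 2 x k) (s'.write 2 x k) := by
          have := h.write 2 x k
          have e : (s'.write 2 x (s 2 x)).write 2 x k = s'.write 2 x k := by
            funext a j
            simp only [Memory.write_apply]
            split_ifs <;> rfl
          rwa [e] at this
        obtain ⟨τ, s'', hx, hτ, hs, hv⟩ := hp (s'.write 2 x k) N (by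
          rwa [hag.1 0 (by decide), Memory.write_of_ne _ _ _ (by decide)])
        refine ⟨_, _, .seq (.write _ _ _ _) (.seq (by simpa [Expr.eval, hd] using hx)
          (.write _ _ _ _)), ?_, ⟨?_, ?_, ?_⟩, ?_⟩
        · simp only [Expr.cost]
          omega
        · have key : AgreeTo d (s.write 2 x k) s'' := hag.trans (hs.mono (by omega))
          have key2 := key.write 2 x (s 2 x)
          have e : (s.write 2 x k).write 2 x (s 2 x) = s := by
            funext a j
            simp only [Memory.write_apply]
            split_ifs with h
            · rw [h.1, h.2]
            · rfl
          rw [e] at key2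
          have e' : ∀ v, (s''.write 3 d v).write 2 x (s 2 x)
              = (s''.write 2 x (s 2 x)).write 3 d v := by
            intro v
            funext a j
            simp only [Memory.write_apply]
            split_ifs <;> omega
          simp only [Expr.eval]
          rw [e']
          exact key2.write_scratch le_rfl _
        · simp only [Expr.eval, Memory.write_apply]
          rw [if_neg (by omega), hs.2 _ (by omega), Memory.write_of_ne _ _ _ (by decide), h2]
        · simp only [Expr.eval, Memory.write_apply, and_self, if_true]
          rw [hv, hs.2 _ (by omega), Memory.write_of_ne _ _ _ (by decide), h3,
            t.eval_congr (hag.mono (Nat.zero_le d)), Finset.sum_range_succ]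
        · simp only [Expr.eval, Memory.write_apply]
          rw [if_neg (by omega), hs.2 _ (by omega), Memory.write_of_ne _ _ _ (by decide), hd])
      (s := (s.write 3 (d + 2) (s 2 x)).write 3 d 0) (by
        refine ⟨?_, ?_, ?_⟩
        · have e : ((s.write 3 (d + 2) (s 2 x)).write 3 d 0).write 2 x (s 2 x)
              = (s.write 3 (d + 2) (s 2 x)).write 3 d 0 := by
            funext a j
            simp only [Memory.write_apply]
            split_ifs with h h' h''
            · omega
            · omega
            · rw [h.1, h.2]
            all_goals rfl
          rw [e]
          exact ((AgreeTo.refl d s).write_scratch (by omega) _).write_scratch le_rfl _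
        · simp [Memory.write_apply]
        · simp [Memory.write_apply])
    refine ⟨_, _, .seq (.write _ _ _ _) (.seq (.write _ _ _ _) (.seq (by
      simpa [Expr.eval] using hx) (.write _ _ _ _))), ?_, ?_, ?_⟩
    · have h1 : (s 0 c + 1) * (f.eval N + 11 + 12) ≤ (N + 1) * (f.eval N + 23) :=
        Nat.mul_le_mul (Nat.succ_le_succ (hN c)) le_rfl
      simp only [Expr.cost, Polynomial.eval_add, Polynomial.eval_mul, Polynomial.eval_X,
        Polynomial.eval_one, Polynomial.eval_ofNat]
      omega
    · simpa [Expr.eval, hd2] using hs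
    · simp [Expr.eval, Memory.write_apply, hacc, Term.eval]

/-- Loop bounds thus stay fixed throughout a run, which is what makes the time bound compose. -/
theorem Stmt.run_zero (p : Stmt) (s : Memory) : p.run s 0 = s 0 := by
  induction p generalizing s with
  | assign a ha i t => exact Memory.write_of_ne _ _ _ (by omega)
  | seq p q ihp ihq => exact (ihq _).trans (ihp _)
  | forRange c x p ih =>
    have : ∀ n, iterateVar p.run x s n 0 = s 0 := by
      intro n
      induction n with
      | zero => rfl
      | succ n ihn => rw [iterateVar, ih, Memory.write_of_ne _ _ _ (by decide), ihn]
    exact this _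

/-- Statements can be run in time polynomial in the numbers in array `0`. -/
theorem Stmt.exists_program (q : Stmt) (d : ℕ) :
    ∃ (p : Program) (f : Polynomial ℕ), ∀ (s₀ s : Memory) (N : ℕ), (∀ c, s 0 c ≤ N) →
      AgreeTo 0 s₀ s → ∃ τ s', Exec p s τ s' ∧ τ ≤ f.eval N ∧ AgreeTo 0 (q.run s₀) s' ∧
        ∀ j, j < d → s' 3 j = s 3 j := by
  induction q generalizing d with
  | assign a ha i t =>
    obtain ⟨p, f, hp⟩ := i.exists_program d
    obtain ⟨q, g, hq⟩ := t.exists_program (d + 1)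
    refine ⟨.seq p (.seq q (.write a (.read 3 (.const d)) (.read 3 (.const (d + 1))))),
      f + (g + 5), fun s₀ s N hN hag => ?_⟩
    obtain ⟨τ, s', hx, hτ, hs, hv⟩ := hp s N hN
    obtain ⟨τ', s'', hx', hτ', hs', hv'⟩ := hq s' N (by rwa [hs.1 0 (by decide)])
    refine ⟨_, _, .seq hx (.seq hx' (.write _ _ _ _)), ?_, ?_, ?_⟩
    · simp only [Expr.cost, Polynomial.eval_add, Polynomial.eval_ofNat]
      omega
    · have h1 : AgreeTo 0 s₀ s' := hag.trans (hs.mono (Nat.zero_le d))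
      have h2 : AgreeTo 0 s₀ s'' := h1.trans (hs'.mono (Nat.zero_le _))
      simp only [Expr.eval, Stmt.run, hs'.2 d (Nat.lt_succ_self d), hv, hv', t.eval_congr h1,
        i.eval_congr hag]
      exact h2.write _ _ _
    · intro j hj
      rw [Memory.write_of_ne _ _ _ (by omega), hs'.2 j (by omega), hs.2 j hj]
  | seq p q ihp ihq =>
    obtain ⟨p', f, hp⟩ := ihp d
    obtain ⟨q', g, hq⟩ := ihq d
    refine ⟨.seq p' q', f + g, fun s₀ s N hN hag => ?_⟩
    obtain ⟨τ, s', hx, hτ, hs, hj⟩ := hp s₀ s N hN hag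
    obtain ⟨τ', s'', hx', hτ', hs', hj'⟩ := hq _ s' N (by
      rwa [hs.1 0 (by decide), Stmt.run_zero, ← hag.1 0 (by decide)]) hs
    refine ⟨_, _, .seq hx hx', ?_, hs', fun j h => (hj' j h).trans (hj j h)⟩
    rw [Polynomial.eval_add]
    omega
  | forRange c x q ih =>
    -- Cell `d` holds the loop counter, so the body has to preserve it.
    obtain ⟨p, f, hp⟩ := ih (d + 1)
    refine ⟨countingLoop c d (.seq (.write 2 (.const x) (.read 3 (.const d))) p),
      (Polynomial.X + 1) * (f + 16) + 3, fun s₀ s N hN hag => ?_⟩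
    have h00 : ∀ n, iterateVar q.run x s₀ n 0 = s₀ 0 := by
      intro n
      induction n with
      | zero => rfl
      | succ n ihn => rw [iterateVar, Stmt.run_zero, Memory.write_of_ne _ _ _ (by decide), ihn]
    obtain ⟨τ, s', hx, hτ, hs, hj⟩ := exec_countingLoop (c := c) (d := d) (n := s₀ 0 c)
      (T := f.eval N + 4) (p := .seq (.write 2 (.const x) (.read 3 (.const d))) p)
      (fun k s' => AgreeTo 0 (iterateVar q.run x s₀ k) s' ∧ ∀ j, j < d → s' 3 j = s 3 j)
      (by
        rintro k s' ⟨h, -⟩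
        rw [h.1 0 (by decide), h00])
      (by
        rintro k s' v ⟨h, h'⟩
        refine ⟨h.write_scratch (Nat.zero_le d) _, fun j hj => ?_⟩
        rw [Memory.write_apply, if_neg (by omega), h' j hj])
      (by
        rintro k s' hk ⟨h, h'⟩ hd
        obtain ⟨τ, s'', hx, hτ, hs, hj⟩ := hp _ (s'.write 2 x k) N (by
          rwa [Memory.write_of_ne _ _ _ (by decide), h.1 0 (by decide), h00,
            ← hag.1 0 (by decide)]) (h.write 2 x k)
        refine ⟨_, s'', .seq (.write _ _ _ _) (by simpa [Expr.eval, hd] using hx), ?_,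
          ⟨hs, fun j h => ?_⟩, ?_⟩
        · simp only [Expr.cost]
          omega
        · rw [hj j (by omega), Memory.write_of_ne _ _ _ (by decide), h' j h]
        · rw [hj d (by omega), Memory.write_of_ne _ _ _ (by decide), hd])
      (s := s) ⟨hag, fun _ _ => rfl⟩
    refine ⟨τ, s', hx, hτ.trans ?_, hs, hj⟩
    have h1 : (s₀ 0 c + 1) * (f.eval N + 4 + 12) ≤ (N + 1) * (f.eval N + 16) :=
      Nat.mul_le_mul (Nat.succ_le_succ (by rw [← hag.1 0 (by decide)]; exact hN c)) le_rfl
    simp only [Polynomial.eval_add, Polynomial.eval_mul, Polynomial.eval_X,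
        Polynomial.eval_one, Polynomial.eval_ofNat]
    omega

/-- The invariant rule for bounded iteration. -/
theorem Stmt.run_forRange_induction {c x : ℕ} {p : Stmt} {s : Memory} (I : ℕ → Memory → Prop)
    (h0 : I 0 s) (hstep : ∀ k s', k < s 0 c → I k s' → I (k + 1) (p.run (s'.write 2 x k))) :
    I (s 0 c) ((Stmt.forRange c x p).run s) := by
  have : ∀ n, n ≤ s 0 c → I n (iterateVar p.run x s n) := by
    intro n
    induction n with
    | zero => exact fun _ => h0
    | succ n ih => exact fun hn => hstep n _ (by omega) (ih (by omega))
  exact this _ le_rfl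

end RAM

/-! ### Colourings and precolourings -/

/-- The colouring `c` describes a perfect matching cut: every vertex has exactly one neighbour of the
other colour. -/
def IsCutColoring {V : Type*} (G : SimpleGraph V) (c : V → Bool) : Prop :=
  ∀ v, ∃! w, G.Adj v w ∧ c w ≠ c v

/-- The colour classes are the two sides of the cut. They are non-empty because some vertex exists
and its partner has the other colour. -/
theorem hasPerfectMatchingCut_iff {V : Type*} [Nonempty V] (G : SimpleGraph V) :
    HasPerfectMatchingCut G ↔ ∃ c, IsCutColoring G c := by
  classical
  constructor
  · rintro ⟨M, hM, B, R, -, -, hd, hu, hE⟩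
    have hR : ∀ v, v ∈ R ↔ v ∉ B := fun v =>
      ⟨fun h h' => Set.disjoint_left.1 hd h' h,
        fun h => (hu.symm ▸ Set.mem_univ v : v ∈ B ∪ R).resolve_left h⟩
    have hadj : ∀ v w, M.Adj v w ↔ G.Adj v w ∧ decide (w ∈ B) ≠ decide (v ∈ B) := by
      intro v w
      rw [← SimpleGraph.Subgraph.mem_edgeSet, hE]
      simp only [Set.mem_ofPred_eq, SimpleGraph.mem_edgeSet, Sym2.eq_iff, hR]
      refine and_congr_right fun _ => ⟨?_, fun h => ?_⟩
      · rintro ⟨x, hx, y, hy, ⟨rfl, rfl⟩ | ⟨rfl, rfl⟩⟩ <;> simp [hx, hy]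
      · by_cases hv : v ∈ B
        · exact ⟨v, hv, w, fun hw => h (by simp [hv, hw]), .inl ⟨rfl, rfl⟩⟩
        · have hw : w ∈ B := by
            by_contra hw
            exact h (by simp [hv, hw])
          exact ⟨w, hw, v, hv, .inr ⟨rfl, rfl⟩⟩
    refine ⟨fun v => decide (v ∈ B), fun v => ?_⟩
    obtain ⟨w, hw, hw'⟩ := hM.1 (hM.2 v)
    exact ⟨w, (hadj v w).1 hw, fun y hy => hw' y ((hadj v y).2 hy)⟩
  · rintro ⟨c, hc⟩
    let M : G.Subgraph :=
      { verts := Set.univ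
        Adj := fun v w => G.Adj v w ∧ c w ≠ c v
        adj_sub := fun h => h.1
        edge_vert := fun _ => Set.mem_univ _
        symm := ⟨fun _ _ h => ⟨h.1.symm, h.2.symm⟩⟩ }
    have hex : ∀ β, ∃ v, c v = β := by
      intro β
      let v : V := Classical.arbitrary V
      obtain ⟨w, ⟨-, hw⟩, -⟩ := hc v
      by_cases hv : c v = β
      · exact ⟨v, hv⟩
      · refine ⟨w, ?_⟩
        cases hcv : c v <;> cases hcw : c w <;> cases β <;> simp_all
    refine ⟨M, ⟨fun v _ => hc v, fun v => Set.mem_univ v⟩, {v | c v = true}, {v | c v = false},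
      hex true, hex false, ?_, ?_, ?_⟩
    · rw [Set.disjoint_left]
      intro v hv hv'
      simp_all
    · ext v
      simp
    · ext e
      induction e with
      | _ v w =>
        simp only [SimpleGraph.Subgraph.mem_edgeSet, Set.mem_ofPred_eq, SimpleGraph.mem_edgeSet,
          Sym2.eq_iff]
        refine and_congr_right fun _ => ⟨fun h => ?_, ?_⟩
        · cases hv : c v
          · exact ⟨w, by simpa [hv] using h, v, hv, .inr ⟨rfl, rfl⟩⟩
          · exact ⟨v, hv, w, by simpa [hv] using h, .inl ⟨rfl, rfl⟩⟩
        · rintro ⟨x, hx, y, hy, ⟨rfl, rfl⟩ | ⟨rfl, rfl⟩⟩ <;> simp [hx, hy]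

/-! ### Completing a precolouring: binary conflicts and one counting condition -/

section Precoloring

variable {V : Type*} (G : SimpleGraph V) (pre : Bool → V → Prop)

/-- The vertex `v` is not precoloured. -/
def Uncolored (v : V) : Prop := ¬ pre true v ∧ ¬ pre false v

/-- The vertex `v` may not get the colour `β`. -/
def Excluded (v : V) (β : Bool) : Prop :=
  pre (!β) v ∨ (Uncolored pre v ∧ ¬ ∃! z, G.Adj v z ∧ pre (!β) z)

/-- The vertices `v` and `w` may not get the colours `β` and `γ` simultaneously. -/
def Conflict (v : V) (β : Bool) (w : V) (γ : Bool) : Prop :=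
  (v = w ∧ β = γ ∧ Excluded G pre v β) ∨
  (Uncolored pre v ∧ Uncolored pre w ∧ G.Adj v w ∧ β ≠ γ) ∨
  (v ≠ w ∧ β = γ ∧ ∃ z, G.Adj z v ∧ G.Adj z w ∧ pre (!β) z)

/-- The colouring `c` respects all conflicts. -/
def RespectsConflicts (c : V → Bool) : Prop :=
  ∀ v w, ¬ Conflict G pre v (c v) w (c w)

/-- A precoloured vertex with a neighbour that is precoloured with the other colour. -/
def Saturated (z : V) : Prop :=
  ∃ β, pre β z ∧ ∃ y, G.Adj z y ∧ pre (!β) y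

variable {G pre}

theorem Conflict.symm {v w : V} {β γ : Bool} (h : Conflict G pre v β w γ) :
    Conflict G pre w γ v β := by
  rcases h with ⟨rfl, rfl, h⟩ | ⟨h1, h2, h3, h4⟩ | ⟨h1, rfl, z, h2, h3, h4⟩
  · exact .inl ⟨rfl, rfl, h⟩
  · exact .inr (.inl ⟨h2, h1, h3.symm, h4.symm⟩)
  · exact .inr (.inr ⟨h1.symm, rfl, z, h3, h2, h4⟩)

theorem not_uncolored {v : V} : ¬ Uncolored pre v ↔ ∃ β, pre β v := by
  unfold Uncolored
  constructor
  · intro h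
    by_contra! h'
    exact h ⟨h' true, h' false⟩
  · rintro ⟨_ | _, h⟩ ⟨h1, h2⟩
    · exact h2 h
    · exact h1 h

variable [Fintype V]

open Classical in
/-- The number of vertices that can be matched with uncoloured vertices is the number of uncoloured
vertices. -/
def Balanced (G : SimpleGraph V) (pre : Bool → V → Prop) : Prop :=
  (Finset.univ.filter (Uncolored pre)).card + (Finset.univ.filter (Saturated G pre)).card =
    (Finset.univ.filter fun z => ¬ Uncolored pre z).card

/-- Conflicts give each uncoloured vertex exactly one opposite neighbour and each precoloured vertex
at most one. Existence for the latter is the pigeonhole principle: the partner map from uncoloured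
to non-saturated precoloured vertices is injective between sets of equal size, hence onto. -/
theorem isCutColoring_of_respectsConflicts {c : V → Bool} (hc : RespectsConflicts G pre c)
    (hbal : Balanced G pre) : IsCutColoring G c := by
  classical
  have hK : ∀ β v, pre β v → c v = β := by
    intro β v h
    by_contra hne
    refine hc v v (.inl ⟨rfl, rfl, .inl ?_⟩)
    rwa [show (!c v) = β by cases hv : c v <;> cases β <;> simp_all]
  have hU : ∀ v, Uncolored pre v → ∃! z, G.Adj v z ∧ pre (!c v) z := by
    intro v hv
    by_contra h
    exact hc v v (.inl ⟨rfl, rfl, .inr ⟨hv, h⟩⟩)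
  have hUU : ∀ v w, Uncolored pre v → Uncolored pre w → G.Adj v w → c v = c w := by
    intro v w hv hw hvw
    by_contra h
    exact hc v w (.inr (.inl ⟨hv, hw, hvw, h⟩))
  have hone : ∀ z v w, ¬ Uncolored pre z → G.Adj z v → G.Adj z w → c v ≠ c z → c w ≠ c z →
      v = w := by
    intro z v w hz hv hw hcv hcw
    by_contra hne
    obtain ⟨β, hβ⟩ := not_uncolored.1 hz
    have hz := hK β z hβ
    refine hc v w (.inr (.inr ⟨hne, ?_, z, hv, hw, ?_⟩))
    · cases h1 : c v <;> cases h2 : c w <;> simp_all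
    · rwa [show (!c v) = β by cases h1 : c v <;> cases β <;> simp_all]
  have hpart : ∀ v, ∃ z, Uncolored pre v → G.Adj v z ∧ pre (!c v) z := by
    intro v
    by_cases hv : Uncolored pre v
    · obtain ⟨z, hz, -⟩ := hU v hv
      exact ⟨z, fun _ => hz⟩
    · exact ⟨v, fun h => absurd h hv⟩
  choose f hf using hpart
  have hfc : ∀ v, Uncolored pre v → c (f v) = !c v := fun v hv => hK _ _ (hf v hv).2
  set U := Finset.univ.filter (Uncolored pre)
  set D := Finset.univ.filter (Saturated G pre)
  set K := Finset.univ.filter fun z => ¬ Uncolored pre z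
  have hDK : D ⊆ K := by
    intro z hz
    obtain ⟨β, h, -⟩ := (Finset.mem_filter.1 hz).2
    exact Finset.mem_filter.2 ⟨Finset.mem_univ z, not_uncolored.2 ⟨β, h⟩⟩
  have himg : U.image f ⊆ K \ D := by
    intro z hz
    obtain ⟨v, hv, rfl⟩ := Finset.mem_image.1 hz
    have hv := (Finset.mem_filter.1 hv).2
    have hfK : ¬ Uncolored pre (f v) := not_uncolored.2 ⟨_, (hf v hv).2⟩
    refine Finset.mem_sdiff.2 ⟨Finset.mem_filter.2 ⟨Finset.mem_univ _, hfK⟩, fun hD => ?_⟩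
    obtain ⟨β, hβ, y, hy, hyβ⟩ := (Finset.mem_filter.1 hD).2
    have h1 := hK _ _ hβ
    have h2 := hK _ _ hyβ
    -- A saturated partner of `v` would have both `v` and a precoloured vertex as opposite
    -- neighbours; these would coincide, but `v` is uncoloured.
    have := hone (f v) v y hfK (hf v hv).1.symm hy (by rw [hfc v hv]; cases c v <;> simp)
      (by rw [h1, h2]; cases β <;> simp)
    subst this
    exact not_uncolored.2 ⟨_, hyβ⟩ hv
  have hinj : Set.InjOn f U := by
    intro v hv w hw h
    have hv := (Finset.mem_filter.1 hv).2
    have hw := (Finset.mem_filter.1 hw).2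
    refine hone (f v) v w (not_uncolored.2 ⟨_, (hf v hv).2⟩) (hf v hv).1.symm
      (h ▸ (hf w hw).1.symm) ?_ ?_
    · rw [hfc v hv]
      cases c v <;> simp
    · rw [h, hfc w hw]
      cases c w <;> simp
  have heq : U.image f = K \ D := by
    refine Finset.eq_of_subset_of_card_le himg ?_
    rw [Finset.card_image_of_injOn hinj, Finset.card_sdiff_of_subset hDK]
    have : U.card + D.card = K.card := hbal
    omega
  intro v
  by_cases hv : Uncolored pre v
  · obtain ⟨z, hz, hz'⟩ := hU v hv
    refine ⟨z, ⟨hz.1, ?_⟩, fun w hw => hz' w ⟨hw.1, ?_⟩⟩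
    · rw [hK _ _ hz.2]
      cases c v <;> simp
    · have hwK : ¬ Uncolored pre w := fun h => hw.2 (hUU v w hv h hw.1).symm
      obtain ⟨β, hβ⟩ := not_uncolored.1 hwK
      have h1 := hK _ _ hβ
      have h2 := hw.2
      rwa [show (!c v) = β by cases h3 : c v <;> cases β <;> simp_all]
  · have hex : ∃ w, G.Adj v w ∧ c w ≠ c v := by
      by_cases hD : v ∈ D
      · obtain ⟨β, hβ, y, hy, hyβ⟩ := (Finset.mem_filter.1 hD).2
        refine ⟨y, hy, ?_⟩
        rw [hK _ _ hβ, hK _ _ hyβ]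
        cases β <;> simp
      · have : v ∈ U.image f := by
          rw [heq]
          exact Finset.mem_sdiff.2 ⟨Finset.mem_filter.2 ⟨Finset.mem_univ v, hv⟩, hD⟩
        obtain ⟨u, hu, rfl⟩ := Finset.mem_image.1 this
        have hu := (Finset.mem_filter.1 hu).2
        refine ⟨u, (hf u hu).1.symm, ?_⟩
        rw [hfc u hu]
        cases c u <;> simp
    obtain ⟨w, hw⟩ := hex
    exact ⟨w, hw, fun y hy => hone v y w hv hy.1 hw.1 hy.2 hw.2⟩

/-- By `hUU` partners of uncoloured vertices are precoloured, so the partner involution carries the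
uncoloured vertices bijectively onto the precoloured, non-saturated ones. -/
theorem IsCutColoring.respectsConflicts_and_balanced {c : V → Bool} (hc : IsCutColoring G c)
    (hpre : ∀ β v, pre β v → c v = β)
    (hUU : ∀ v w, Uncolored pre v → Uncolored pre w → G.Adj v w → c v = c w) :
    RespectsConflicts G pre c ∧ Balanced G pre := by
  classical
  have hop : ∀ β γ : Bool, β ≠ γ → (!γ) = β := by decide
  have hU : ∀ v w, Uncolored pre v → G.Adj v w → c w ≠ c v → pre (!c v) w := by
    intro v w hv hvw hne
    have hwK : ¬ Uncolored pre w := fun h => hne (hUU v w hv h hvw).symm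
    obtain ⟨β, hβ⟩ := not_uncolored.1 hwK
    rwa [hop _ _ hne, hpre _ _ hβ]
  constructor
  · rintro v w (⟨rfl, -, h | ⟨h1, h2⟩⟩ | ⟨h1, h2, h3, h4⟩ | ⟨h1, h2, z, h3, h4, h5⟩)
    · exact absurd (hpre _ _ h) (by cases c v <;> simp)
    · obtain ⟨w, hw, hw'⟩ := hc v
      refine h2 ⟨w, ⟨hw.1, hU v w h1 hw.1 hw.2⟩, fun y hy => hw' y ⟨hy.1, ?_⟩⟩
      rw [hpre _ _ hy.2]
      cases c v <;> simp
    · exact h4 (hUU v w h1 h2 h3)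
    · have hz := hpre _ _ h5
      refine h1 ((hc z).unique ⟨h3, ?_⟩ ⟨h4, ?_⟩)
      · rw [hz]
        cases c v <;> simp
      · rw [hz, ← h2]
        cases c v <;> simp
  · choose f hf hf' using hc
    have hff : ∀ v, f (f v) = v := fun v => (hf' (f v) v ⟨(hf v).1.symm, (hf v).2.symm⟩).symm
    unfold Balanced
    set U := Finset.univ.filter (Uncolored pre)
    set D := Finset.univ.filter (Saturated G pre)
    set K := Finset.univ.filter fun z => ¬ Uncolored pre z
    have hDK : D ⊆ K := by
      intro z hz
      obtain ⟨β, h, -⟩ := (Finset.mem_filter.1 hz).2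
      exact Finset.mem_filter.2 ⟨Finset.mem_univ z, not_uncolored.2 ⟨β, h⟩⟩
    have himg : U.image f = K \ D := by
      ext z
      simp only [U, K, D, Finset.mem_image, Finset.mem_sdiff, Finset.mem_filter, Finset.mem_univ,
        true_and]
      constructor
      · rintro ⟨v, hv, rfl⟩
        refine ⟨not_uncolored.2 ⟨_, hU v _ hv (hf v).1 (hf v).2⟩, ?_⟩
        rintro ⟨β, hβ, y, hy, hyβ⟩
        have : y = f (f v) := hf' (f v) y ⟨hy, by
          rw [hpre _ _ hβ, hpre _ _ hyβ]
          cases β <;> simp⟩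
        rw [hff] at this
        subst this
        exact not_uncolored.2 ⟨_, hyβ⟩ hv
      · rintro ⟨hz, hzD⟩
        refine ⟨f z, ?_, hff z⟩
        by_contra h
        obtain ⟨β, hβ⟩ := not_uncolored.1 hz
        obtain ⟨γ, hγ⟩ := not_uncolored.1 h
        refine hzD ⟨β, hβ, f z, (hf z).1, ?_⟩
        have := (hf z).2
        rw [hpre _ _ hβ, hpre _ _ hγ] at this
        rwa [hop _ _ this]
    have := congrArg Finset.card himg
    rw [Finset.card_image_of_injective _ (Function.LeftInverse.injective hff),
      Finset.card_sdiff_of_subset hDK] at this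
    -- Needed to undo the truncated subtraction in the cardinality of `K \ D`.
    have := Finset.card_le_card hDK
    omega

end Precoloring

/-! ### Radius two: the precolouring determined by a centre and its partner -/

/-- The precolouring for a vertex `r` of colour `false` that is matched with `b`. -/
def starPre {V : Type*} (G : SimpleGraph V) (r b : V) : Bool → V → Prop
  | true, v => v ≠ r ∧ (v = b ∨ G.Adj v b)
  | false, v => ¬ (v ≠ r ∧ (v = b ∨ G.Adj v b)) ∧ (v = r ∨ G.Adj v r)

/-- The right-hand side does not ask `r` to be a centre, nor `b` to be adjacent to it: soundness
holds for every precolouring. For completeness `r` is a centre and `b` its partner. -/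
theorem exists_isCutColoring_iff {V : Type*} [Fintype V] {G : SimpleGraph V} (hG : G.radius ≤ 2) :
    (∃ c, IsCutColoring G c) ↔
      ∃ r b, Balanced G (starPre G r b) ∧ ∃ c, RespectsConflicts G (starPre G r b) c := by
  refine ⟨fun ⟨c, hc⟩ => ?_, fun ⟨r, b, hbal, c, hc⟩ =>
    ⟨c, isCutColoring_of_respectsConflicts hc hbal⟩⟩
  have hne : Nonempty V := by
    by_contra h
    rw [not_nonempty_iff] at h
    rw [SimpleGraph.radius_eq_top_of_isEmpty] at hG
    simp at hG
  obtain ⟨r, hr⟩ := G.exists_eccent_eq_radius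
  have hdist : ∀ v, v = r ∨ G.Adj v r ∨ ∃ x, G.Adj x r ∧ G.Adj v x := by
    intro v
    have h2 : G.edist v r ≤ 2 := by
      rw [SimpleGraph.edist_comm]
      exact (SimpleGraph.edist_le_eccent.trans_eq hr).trans hG
    have htop : G.edist v r ≠ ⊤ := ne_top_of_le_ne_top (by decide) h2
    obtain ⟨p, hp⟩ := SimpleGraph.exists_walk_of_edist_ne_top htop
    rw [← hp] at h2
    have h2 : p.length ≤ 2 := by exact_mod_cast h2
    match p, h2 with
    | .nil, _ => exact .inl rfl
    | .cons h .nil, _ => exact .inr (.inl h)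
    | .cons h (.cons h' .nil), _ => exact .inr (.inr ⟨_, h', h⟩)
    | .cons _ (.cons _ (.cons _ _)), h => simp at h
  -- Exchanging the two colours preserves cut colourings, so `r` may be assumed `false`.
  obtain ⟨c, hc, hcr⟩ : ∃ c, IsCutColoring G c ∧ c r = false := by
    cases h : c r
    · exact ⟨c, hc, h⟩
    · refine ⟨fun v => !c v, fun v => ?_, by simp [h]⟩
      simpa using hc v
  obtain ⟨b, ⟨hrb, hcb⟩, hb⟩ := hc r
  have hcb : c b = true := by simpa [hcr] using hcb
  have hred : ∀ v, G.Adj v r → v ≠ b → c v = false := by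
    intro v hv hvb
    by_contra h
    exact hvb (hb v ⟨hv.symm, by simpa [hcr] using h⟩)
  have hblue : ∀ v, G.Adj v b → v ≠ r → c v = true := by
    intro v hv hvr
    by_contra h
    exact hvr ((hc b).unique ⟨hv.symm, by simpa [hcb] using h⟩ ⟨hrb.symm, by simp [hcb, hcr]⟩)
  have hpre : ∀ β v, starPre G r b β v → c v = β := by
    rintro (_ | _) v h
    · obtain ⟨h1, rfl | h2⟩ := h
      · exact hcr
      · refine hred v h2 ?_
        rintro rfl
        exact h1 ⟨h2.ne, .inl rfl⟩
    · obtain ⟨h1, rfl | h2⟩ := h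
      · exact hcb
      · exact hblue v h2 h1
  -- The middle vertex of a path of length two from `v` to `r` is not `b`, since a neighbour of `b`
  -- other than `r` is precoloured; so it is a `false` neighbour of `r`.
  have hUred : ∀ v, Uncolored (starPre G r b) v → ∃ x, G.Adj v x ∧ c x = false ∧
      ¬ Uncolored (starPre G r b) x := by
    rintro v ⟨h1, h2⟩
    rcases hdist v with h | h | ⟨x, hx, hvx⟩
    · exact absurd ⟨h1, .inl h⟩ h2
    · exact absurd ⟨h1, .inr h⟩ h2
    · have hxb : x ≠ b := by
        rintro rfl
        have hvr : v = r := by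
          by_contra hvr
          exact h1 ⟨hvr, .inr hvx⟩
        exact h2 ⟨h1, .inl hvr⟩
      exact ⟨x, hvx, hred x hx hxb, fun h => h.2 ⟨h.1, .inr hx⟩⟩
  have hUU : ∀ v w, Uncolored (starPre G r b) v → Uncolored (starPre G r b) w → G.Adj v w →
      c v = true → c w = true := by
    intro v w hv hw hvw hcv
    by_contra hcw
    -- If `w` were `false`, it would be the unique `false` neighbour of `v`, hence equal to the
    -- precoloured vertex `x`.
    obtain ⟨x, hx, hcx, hxK⟩ := hUred v hv
    have : x = w := (hc v).unique ⟨hx, by simp [hcv, hcx]⟩ ⟨hvw, by simpa [hcv] using hcw⟩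
    exact hxK (this ▸ hw)
  obtain ⟨h1, h2⟩ := hc.respectsConflicts_and_balanced hpre fun v w hv hw hvw => by
    have h1 := hUU v w hv hw hvw
    have h2 := hUU w v hw hv hvw.symm
    cases h3 : c v <;> cases h4 : c w <;> simp_all
  exact ⟨r, b, h2, c, h1⟩

/-! ### Satisfiability of binary clauses -/

/-- The negation of a literal. -/
def litNeg {V : Type*} (l : V × Bool) : V × Bool := (l.1, !l.2)

/-- If a transitive implication between literals is closed under contraposition and makes no
literal equivalent to its negation, then it is respected by an assignment of truth values. -/
theorem exists_assignment {V : Type*} [Finite V] {S : V × Bool → V × Bool → Prop}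
    (htrans : ∀ l m k, S l m → S m k → S l k) (hskew : ∀ l m, S l m → S (litNeg m) (litNeg l))
    (hcons : ∀ v, ¬ (S (v, false) (v, true) ∧ S (v, true) (v, false))) :
    ∃ c : V → Bool, ∀ l m, S l m → c l.1 = l.2 → c m.1 = m.2 := by
  have hneg : ∀ l : V × Bool, litNeg (litNeg l) = l := fun l => by simp [litNeg]
  let good : Set (Set (V × Bool)) :=
    {A | (∀ l m, l ∈ A → S l m → m ∈ A) ∧ ∀ l, l ∈ A → litNeg l ∉ A}
  -- A maximal set of literals that is closed under implication and free of complementary pairs will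
  -- turn out to decide every variable.
  obtain ⟨A, -, hA⟩ := (Set.toFinite good).exists_le_maximal (a := ∅) (by simp [good])
  obtain ⟨hcl, hco⟩ : A ∈ good := hA.prop
  have key : ∀ l : V × Bool, litNeg l ∉ A → ¬ S l (litNeg l) → l ∈ A := by
    intro l hl hS
    -- Adding `l` with all its consequences keeps the set good: by contraposition, a complementary
    -- pair would put `litNeg l` in `A` or make `l` imply it.
    have hB : A ∪ {m | m = l ∨ S l m} ∈ good := by
      refine ⟨?_, ?_⟩
      · rintro m k (hm | rfl | hm) hmk
        · exact .inl (hcl m k hm hmk)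
        · exact .inr (.inr hmk)
        · exact .inr (.inr (htrans _ _ _ hm hmk))
      · rintro m (hm | rfl | hm) (hm' | hm' | hm')
        · exact hco m hm hm'
        · exact hl (by rw [← hm', hneg]; exact hm)
        · have := hskew _ _ hm'
          rw [hneg] at this
          exact hl (hcl _ _ hm this)
        · exact hl hm'
        · simp [litNeg, Prod.ext_iff] at hm'
        · exact hS hm'
        · exact hl (hcl _ _ hm' (hskew _ _ hm))
        · rw [← hm', hneg] at hS
          exact hS (hm' ▸ hm)
        · have := hskew _ _ hm'
          rw [hneg] at this
          exact hS (htrans _ _ _ hm this)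
    exact hA.le_of_ge hB Set.subset_union_left (.inr (.inl rfl))
  have htot : ∀ v, (v, false) ∈ A ∨ (v, true) ∈ A := by
    intro v
    by_contra! h
    refine hcons v ⟨?_, ?_⟩
    · by_contra hS
      exact h.1 (key (v, false) h.2 hS)
    · by_contra hS
      exact h.2 (key (v, true) h.1 hS)
  classical
  have hmem : ∀ l : V × Bool, decide ((l.1, true) ∈ A) = l.2 ↔ l ∈ A := by
    rintro ⟨v, _ | _⟩
    · have := hco (v, true)
      have := htot v
      simp only [litNeg, Bool.not_true] at *
      rw [decide_eq_false_iff_not]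
      tauto
    · simp
  exact ⟨fun v => decide ((v, true) ∈ A), fun l m hS hl =>
    (hmem m).2 (hcl l m ((hmem l).1 hl) hS)⟩

namespace RAM

/-! ### Formulas -/

namespace Term

/-- A term, read as a truth value. -/
def Holds (t : Term) (s : Memory) : Prop := t.eval s ≠ 0

/-- The variable `x`. -/
def var (x : ℕ) : Term := .read 2 (by decide) (.const x)

/-- Negation. -/
def neg (t : Term) : Term := .sub (.const 1) t

/-- Conjunction. -/
def land (t u : Term) : Term := neg (.add (neg t) (neg u))

/-- Disjunction. -/
def lor (t u : Term) : Term := .add t u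

/-- Equality. -/
def eq (t u : Term) : Term := neg (.add (.sub t u) (.sub u t))

/-- Existence of a value of `x` below the contents of cell `0` of array `0`. -/
def ex (x : ℕ) (t : Term) : Term := .sum 0 x t

/-- The number of values of `x` below the contents of cell `0` of array `0` that satisfy `t`. -/
def count (x : ℕ) (t : Term) : Term := .sum 0 x (neg (neg t))

/-- Disjunction over the two truth values. -/
def anyBool (t : Bool → Term) : Term := lor (t false) (t true)

variable {s : Memory}

@[simp] theorem eval_var (x : ℕ) : (var x).eval s = s 2 x := rfl

@[simp] theorem holds_neg (t : Term) : (neg t).Holds s ↔ ¬ t.Holds s := by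
  simp only [Holds, neg, eval]
  omega

@[simp] theorem holds_land (t u : Term) : (land t u).Holds s ↔ t.Holds s ∧ u.Holds s := by
  simp only [Holds, land, neg, eval]
  omega

@[simp] theorem holds_lor (t u : Term) : (lor t u).Holds s ↔ t.Holds s ∨ u.Holds s := by
  simp only [Holds, lor, eval]
  omega

@[simp] theorem holds_eq (t u : Term) : (eq t u).Holds s ↔ t.eval s = u.eval s := by
  simp only [Holds, eq, neg, eval]
  omega

@[simp] theorem holds_anyBool (t : Bool → Term) :
    (anyBool t).Holds s ↔ ∃ β, (t β).Holds s := by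
  simp [anyBool]

theorem holds_ex {n : ℕ} (hn : s 0 0 = n) (x : ℕ) (t : Term) :
    (ex x t).Holds s ↔ ∃ k : Fin n, t.Holds (s.write 2 x k) := by
  subst hn
  simp only [Holds, ex, eval]
  rw [Ne, Finset.sum_eq_zero_iff]
  simp [Fin.exists_iff]

theorem eval_count {n : ℕ} (hn : s 0 0 = n) (x : ℕ) (t : Term) (P : Fin n → Prop)
    [DecidablePred P] (h : ∀ k : Fin n, t.Holds (s.write 2 x k) ↔ P k) :
    (count x t).eval s = (Finset.univ.filter P).card := by
  subst hn
  simp only [count, eval, neg]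
  rw [Finset.sum_range, Finset.card_filter]
  refine Finset.sum_congr rfl fun k _ => ?_
  have := h k
  unfold Holds at this
  split_ifs with hk
  · have := this.2 hk
    omega
  · have : ¬ _ := fun h => hk (this.1 h)
    omega

end Term

open Term

/-! ### Transitive closure -/

/-- The index of an entry of the matrix in array `4`, whose dimension is stored in cell `1` of
array `0`. -/
def index (t u : Term) : Term := .add (.sum 1 30 t) u

/-- An entry of the matrix in array `4`. -/
def entry (t u : Term) : Term := .read 4 (by decide) (index t u)

/-- The relation described by the matrix in array `4`. -/
def Memory.Rel (s : Memory) (i j : ℕ) : Prop := s 4 (s 0 1 * i + j) ≠ 0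

theorem eval_index_var (s : Memory) {x : ℕ} (hx : x ≠ 30) (y : ℕ) :
    (index (var x) (var y)).eval s = s 0 1 * s 2 x + s 2 y := by
  simp [index, eval, Memory.write_apply, hx]

theorem holds_entry_var (s : Memory) {x : ℕ} (hx : x ≠ 30) (y : ℕ) :
    (entry (var x) (var y)).Holds s ↔ s.Rel (s 2 x) (s 2 y) := by
  rw [Holds, entry, eval, eval_index_var s hx, Memory.Rel]

/-- The memories agree on the input, on the answer, and on the variables `0` and `1`. -/
def SameInput (s s' : Memory) : Prop :=
  s' 0 = s 0 ∧ s' 1 = s 1 ∧ s' 2 0 = s 2 0 ∧ s' 2 1 = s 2 1 ∧ s' 5 = s 5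

theorem SameInput.refl (s : Memory) : SameInput s s := ⟨rfl, rfl, rfl, rfl, rfl⟩

theorem SameInput.trans {s s' s'' : Memory} (h : SameInput s s') (h' : SameInput s' s'') :
    SameInput s s'' := by
  obtain ⟨h1, h2, h3, h4, h5⟩ := h
  obtain ⟨h1', h2', h3', h4', h5'⟩ := h'
  exact ⟨h1'.trans h1, h2'.trans h2, h3'.trans h3, h4'.trans h4, h5'.trans h5⟩

theorem SameInput.write_var {s s' : Memory} (h : SameInput s s') {x : ℕ} (hx : 1 < x) (k : ℕ) :
    SameInput s (s'.write 2 x k) := by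
  refine h.trans ⟨?_, ?_, ?_, ?_, ?_⟩
  · exact Memory.write_of_ne _ _ _ (by decide)
  · exact Memory.write_of_ne _ _ _ (by decide)
  · rw [Memory.write_apply, if_neg (by omega)]
  · rw [Memory.write_apply, if_neg (by omega)]
  · exact Memory.write_of_ne _ _ _ (by decide)

theorem SameInput.write_matrix {s s' : Memory} (h : SameInput s s') (k v : ℕ) :
    SameInput s (s'.write 4 k v) := by
  refine h.trans ⟨?_, ?_, ?_, ?_, ?_⟩ <;> rw [Memory.write_of_ne _ _ _ (by decide)]

theorem Memory.rel_write_var (s : Memory) (x k i j : ℕ) :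
    (s.write 2 x k).Rel i j ↔ s.Rel i j := by
  simp [Memory.Rel, Memory.write_apply]

theorem index_inj {N i j i' j' : ℕ} (hj : j < N) (hj' : j' < N) :
    N * i' + j' = N * i + j ↔ i' = i ∧ j' = j := by
  refine ⟨fun h => ?_, by rintro ⟨rfl, rfl⟩; rfl⟩
  have hN : 0 < N := by omega
  have h1 := congrArg (· / N) h
  have h2 := congrArg (· % N) h
  simp only [Nat.mul_add_div hN, Nat.div_eq_of_lt hj, Nat.div_eq_of_lt hj', Nat.mul_add_mod,
    Nat.mod_eq_of_lt hj, Nat.mod_eq_of_lt hj'] at h1 h2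
  omega

theorem Memory.rel_write_matrix (s : Memory) {i j v i' j' : ℕ} (hj : j < s 0 1)
    (hj' : j' < s 0 1) :
    (s.write 4 (s 0 1 * i + j) v).Rel i' j' ↔
      if i' = i ∧ j' = j then v ≠ 0 else s.Rel i' j' := by
  have h0 : s.write 4 (s 0 1 * i + j) v 0 1 = s 0 1 := by
    rw [Memory.write_of_ne _ _ _ (by decide)]
  simp only [Memory.Rel, h0]
  simp only [Memory.write_apply, true_and, index_inj hj hj']
  split_ifs <;> rfl

/-- Fill the matrix with the values of a term in the variables `2` and `3`. -/
def fill (t : Term) : Stmt :=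
  .forRange 1 2 (.forRange 1 3 (.assign 4 (by decide) (index (var 2) (var 3)) t))

/-- `hP` is required in every memory with the same input, because `t` is evaluated while the matrix
is partly overwritten. -/
theorem fill_spec (t : Term) (s : Memory) (P : ℕ → ℕ → Prop)
    (hP : ∀ s', SameInput s s' → (t.Holds s' ↔ P (s' 2 2) (s' 2 3))) :
    SameInput s ((fill t).run s) ∧
      ∀ i j, i < s 0 1 → j < s 0 1 → (((fill t).run s).Rel i j ↔ P i j) := by
  refine Stmt.run_forRange_induction (fun k s' => SameInput s s' ∧
    ∀ i j, i < k → j < s 0 1 → (s'.Rel i j ↔ P i j)) ⟨SameInput.refl s, by omega⟩ ?_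
  rintro k s' - ⟨hs, h⟩
  have hs1 := hs.write_var (x := 2) (by decide) k
  have := Stmt.run_forRange_induction (c := 1) (x := 3)
    (p := .assign 4 (by decide) (index (var 2) (var 3)) t) (s := s'.write 2 2 k)
    (fun l s'' => SameInput s s'' ∧ s'' 2 2 = k ∧
      ∀ i j, j < s 0 1 → (i < k ∨ i = k ∧ j < l) → (s''.Rel i j ↔ P i j))
    ⟨hs1, by simp [Memory.write_apply], fun i j hj hi => by
      rw [Memory.rel_write_var]
      exact h i j (by omega) hj⟩ ?_
  · rw [hs1.1] at this
    exact ⟨this.1, fun i j hi hj => this.2.2 i j hj (by omega)⟩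
  · rintro l s'' hl ⟨hs2, hk, h2⟩
    rw [hs1.1] at hl
    have hs3 := hs2.write_var (x := 3) (by decide) l
    have e : (index (var 2) (var 3)).eval (s''.write 2 3 l) =
        (s''.write 2 3 l) 0 1 * k + l := by
      rw [eval_index_var _ (by decide)]
      simp [Memory.write_apply, hk]
    simp only [Stmt.run, e]
    refine ⟨hs3.write_matrix _ _, by simp [Memory.write_apply, hk], fun i j hj hi => ?_⟩
    rw [Memory.rel_write_matrix _ (by rwa [hs3.1]) (by rwa [hs3.1])]
    split_ifs with hij
    · obtain ⟨rfl, rfl⟩ := hij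
      have := hP _ hs3
      simpa [Memory.write_apply, hk, Holds] using this
    · rw [Memory.rel_write_var]
      exact h2 i j hj (by omega)

/-- Reachability by paths whose inner vertices are smaller than `k`. -/
def BoundedReach (E : ℕ → ℕ → Prop) : ℕ → ℕ → ℕ → Prop
  | 0, i, j => E i j
  | k + 1, i, j => BoundedReach E k i j ∨ (BoundedReach E k i k ∧ BoundedReach E k k j)

/-- Two paths can be joined at an inner vertex below `k`. With `k` the number of indices this is
full transitivity, although `BoundedReach` never iterates through the same vertex twice. -/
theorem BoundedReach.trans {E : ℕ → ℕ → Prop} {k i j m : ℕ} (hm : m < k)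
    (h : BoundedReach E k i m) (h' : BoundedReach E k m j) : BoundedReach E k i j := by
  induction k generalizing i j m with
  | zero => omega
  | succ k ih =>
    simp only [BoundedReach] at *
    rcases Nat.lt_succ_iff_lt_or_eq.1 hm with hm | rfl
    · rcases h with h | ⟨h1, h2⟩ <;> rcases h' with h' | ⟨h1', h2'⟩
      · exact .inl (ih hm h h')
      · exact .inr ⟨ih hm h h1', h2'⟩
      · exact .inr ⟨h1, ih hm h2 h'⟩
      · exact .inr ⟨h1, h2'⟩
    · tauto

theorem boundedReach_of_rel {E : ℕ → ℕ → Prop} {i j : ℕ} (h : E i j) (k : ℕ) :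
    BoundedReach E k i j := by
  induction k with
  | zero => exact h
  | succ k ih => exact .inl ih

/-- Replace the relation described by the matrix by its transitive closure. -/
def close : Stmt :=
  .forRange 1 4 (.forRange 1 2 (.forRange 1 3 (.assign 4 (by decide) (index (var 2) (var 3))
    (lor (entry (var 2) (var 3)) (land (entry (var 2) (var 4)) (entry (var 4) (var 3)))))))

theorem close_step (s : Memory) (h3 : s 2 3 < s 0 1) {i j : ℕ}
    (hj : j < s 0 1) :
    ((Stmt.assign 4 (by decide) (index (var 2) (var 3))
      (lor (entry (var 2) (var 3))
        (land (entry (var 2) (var 4)) (entry (var 4) (var 3))))).run s).Rel i j ↔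
      s.Rel i j ∨ (i = s 2 2 ∧ j = s 2 3 ∧ s.Rel (s 2 2) (s 2 4) ∧ s.Rel (s 2 4) (s 2 3)) := by
  simp only [Stmt.run, eval_index_var s (show 2 ≠ 30 by decide)]
  rw [Memory.rel_write_matrix _ h3 hj]
  split_ifs with h
  · obtain ⟨rfl, rfl⟩ := h
    change Term.Holds _ _ ↔ _
    simp [holds_entry_var]
  · tauto

/-- Warshall's algorithm works in place, so after `k` rounds the matrix may contain more than
`BoundedReach E k`. It is therefore only sandwiched: between that relation and an arbitrary
transitive relation containing `E`. -/
theorem close_bounds (s : Memory) {E T : ℕ → ℕ → Prop}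
    (hE : ∀ i j, i < s 0 1 → j < s 0 1 → (s.Rel i j ↔ E i j))
    (hET : ∀ i j, i < s 0 1 → j < s 0 1 → E i j → T i j)
    (hT : ∀ i j k, i < s 0 1 → j < s 0 1 → k < s 0 1 → T i j → T j k → T i k) :
    SameInput s (close.run s) ∧ ∀ i j, i < s 0 1 → j < s 0 1 →
      (BoundedReach E (s 0 1) i j → (close.run s).Rel i j) ∧ ((close.run s).Rel i j → T i j) := by
  refine Stmt.run_forRange_induction (fun k s' => SameInput s s' ∧ ∀ i j, i < s 0 1 → j < s 0 1 →
      (BoundedReach E k i j → s'.Rel i j) ∧ (s'.Rel i j → T i j))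
    ⟨SameInput.refl s, fun i j hi hj =>
      ⟨(hE i j hi hj).2, fun h => hET i j hi hj ((hE i j hi hj).1 h)⟩⟩ ?_
  rintro k s' hk ⟨hs, h⟩
  have hs1 := hs.write_var (x := 4) (by decide) k
  have := Stmt.run_forRange_induction (c := 1) (x := 2)
    (p := .forRange 1 3 (.assign 4 (by decide) (index (var 2) (var 3))
      (lor (entry (var 2) (var 3)) (land (entry (var 2) (var 4)) (entry (var 4) (var 3))))))
    (s := s'.write 2 4 k)
    -- Within round `k`, rows below `l` have reached the next lower bound, while all entries keep
    -- the old one.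
    (fun l s'' => SameInput s s'' ∧ s'' 2 4 = k ∧ ∀ i j, i < s 0 1 → j < s 0 1 →
      (BoundedReach E k i j → s''.Rel i j) ∧ (i < l → BoundedReach E (k + 1) i j → s''.Rel i j) ∧
        (s''.Rel i j → T i j))
    ⟨hs1, by simp [Memory.write_apply], fun i j hi hj => by
      rw [Memory.rel_write_var]
      exact ⟨(h i j hi hj).1, fun h => absurd h (Nat.not_lt_zero i), (h i j hi hj).2⟩⟩ ?_
  · rw [hs1.1] at this
    exact ⟨this.1, fun i j hi hj =>
      ⟨(this.2.2 i j hi hj).2.1 hi, (this.2.2 i j hi hj).2.2⟩⟩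
  rintro l s2 hl ⟨hs2, hk2, h2⟩
  rw [hs1.1] at hl
  have hs3 := hs2.write_var (x := 2) (by decide) l
  have := Stmt.run_forRange_induction (c := 1) (x := 3)
    (p := .assign 4 (by decide) (index (var 2) (var 3))
      (lor (entry (var 2) (var 3)) (land (entry (var 2) (var 4)) (entry (var 4) (var 3)))))
    (s := s2.write 2 2 l)
    (fun m s'' => SameInput s s'' ∧ s'' 2 4 = k ∧ s'' 2 2 = l ∧ ∀ i j, i < s 0 1 → j < s 0 1 →
      (BoundedReach E k i j → s''.Rel i j) ∧
        (i < l ∨ i = l ∧ j < m → BoundedReach E (k + 1) i j → s''.Rel i j) ∧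
        (s''.Rel i j → T i j))
    ⟨hs3, by simp [Memory.write_apply, hk2], by simp [Memory.write_apply], fun i j hi hj => by
      rw [Memory.rel_write_var]
      exact ⟨(h2 i j hi hj).1, fun h => (h2 i j hi hj).2.1 (by omega), (h2 i j hi hj).2.2⟩⟩ ?_
  · rw [hs3.1] at this
    exact ⟨this.1, this.2.1, fun i j hi hj =>
      ⟨(this.2.2.2 i j hi hj).1, fun hil => (this.2.2.2 i j hi hj).2.1 (by omega),
        (this.2.2.2 i j hi hj).2.2⟩⟩
  rintro m s4 hm ⟨hs4, hk4, hl4, h4⟩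
  rw [hs3.1] at hm
  have hs5 := hs4.write_var (x := 3) (by decide) m
  have e2 : (s4.write 2 3 m) 2 2 = l := by simp [Memory.write_apply, hl4]
  have e3 : (s4.write 2 3 m) 2 3 = m := by simp [Memory.write_apply]
  have e4 : (s4.write 2 3 m) 2 4 = k := by simp [Memory.write_apply, hk4]
  refine ⟨hs5.write_matrix _ _, by simp [Stmt.run, Memory.write_apply, hk4],
    by simp [Stmt.run, Memory.write_apply, hl4], fun i j hi hj => ?_⟩
  rw [close_step _ (by rwa [e3, hs5.1]) (by rwa [hs5.1])]
  simp only [e2, e3, e4, Memory.rel_write_var]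
  refine ⟨fun h => .inl ((h4 i j hi hj).1 h), fun hij hr => ?_, ?_⟩
  · by_cases hlm : i = l ∧ j = m
    · obtain ⟨rfl, rfl⟩ := hlm
      rcases hr with hr | ⟨hr1, hr2⟩
      · exact .inl ((h4 _ _ hi hj).1 hr)
      · exact .inr ⟨rfl, rfl, (h4 _ _ hi hk).1 hr1, (h4 _ _ hk hj).1 hr2⟩
    · exact .inl ((h4 i j hi hj).2.1 (by omega) hr)
  · rintro (h | ⟨rfl, rfl, h1, h2⟩)
    · exact (h4 i j hi hj).2.2 h
    · exact hT _ _ _ hi hk hj ((h4 _ _ hi hk).2.2 h1) ((h4 _ _ hk hj).2.2 h2)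

/-- With `T` the full bounded reachability the two bounds of `close_bounds` meet, which gives
transitivity; a general `T` gives minimality. -/
theorem close_spec (s : Memory) {E : ℕ → ℕ → Prop}
    (hE : ∀ i j, i < s 0 1 → j < s 0 1 → (s.Rel i j ↔ E i j)) :
    SameInput s (close.run s) ∧
    (∀ i j, i < s 0 1 → j < s 0 1 → E i j → (close.run s).Rel i j) ∧
    (∀ i j k, i < s 0 1 → j < s 0 1 → k < s 0 1 →
      (close.run s).Rel i j → (close.run s).Rel j k → (close.run s).Rel i k) ∧
    ∀ T : ℕ → ℕ → Prop, (∀ i j, i < s 0 1 → j < s 0 1 → E i j → T i j) →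
      (∀ i j k, i < s 0 1 → j < s 0 1 → k < s 0 1 → T i j → T j k → T i k) →
      ∀ i j, i < s 0 1 → j < s 0 1 → (close.run s).Rel i j → T i j := by
  obtain ⟨h1, h2⟩ := close_bounds s hE (T := BoundedReach E (s 0 1))
    (fun i j _ _ h => boundedReach_of_rel h _) (fun i j k _ hj _ h h' => h.trans hj h')
  refine ⟨h1, fun i j hi hj h => (h2 i j hi hj).1 (boundedReach_of_rel h _), fun i j k hi hj hk h h' => ?_,
    fun T hET hT i j hi hj => ((close_bounds s hE hET hT).2 i j hi hj).2⟩
  exact (h2 i k hi hk).1 (((h2 i j hi hj).2 h).trans hj ((h2 j k hj hk).2 h'))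

/-! ### The algorithm -/

/-- Adjacency of the vertices in two variables. -/
def adj (x y : ℕ) : Term := .read 1 (by decide) (.add (.sum 0 30 (var x)) (var y))

/-- The vertex in the variable `x` is precoloured with `β`, where the variables `0` and `1` hold
the parameters of the precolouring. -/
def preTerm : Bool → ℕ → Term
  | true, x => land (neg (eq (var x) (var 0))) (lor (eq (var x) (var 1)) (adj x 1))
  | false, x => land (neg (land (neg (eq (var x) (var 0))) (lor (eq (var x) (var 1)) (adj x 1))))
      (lor (eq (var x) (var 0)) (adj x 0))

/-- The vertex in the variable `x` is not precoloured. -/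
def uncoloredTerm (x : ℕ) : Term := land (neg (preTerm true x)) (neg (preTerm false x))

/-- The vertex in the variable `x` may not get the colour `β`. -/
def excludedTerm (x : ℕ) (β : Bool) : Term :=
  lor (preTerm (!β) x) (land (uncoloredTerm x)
    (neg (eq (count 7 (land (adj x 7) (preTerm (!β) 7))) (.const 1))))

/-- The vertices in the variables `5` and `6` may not get the colours `β` and `γ`
simultaneously. -/
def conflictTerm (β γ : Bool) : Term :=
  if β = γ then
    lor (land (eq (var 5) (var 6)) (excludedTerm 5 β))
      (land (neg (eq (var 5) (var 6)))
        (ex 7 (land (adj 7 5) (land (adj 7 6) (preTerm (!β) 7)))))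
  else land (uncoloredTerm 5) (land (uncoloredTerm 6) (adj 5 6))

/-- The number of the literal that gives the colour `β` to the vertex in the variable `x`. -/
def litTerm (x : ℕ) (β : Bool) : Term := .add (.add (var x) (var x)) (.const β.toNat)

/-- The literal in the variable `2` implies the literal in the variable `3`. -/
def impliesTerm : Term :=
  ex 5 (ex 6 (anyBool fun β => anyBool fun γ =>
    land (eq (var 2) (litTerm 5 β)) (land (eq (var 3) (litTerm 6 γ)) (conflictTerm β (!γ)))))

/-- The precolouring is balanced. -/
def balancedTerm : Term :=
  eq (.add (count 5 (uncoloredTerm 5))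
      (count 5 (anyBool fun β => land (preTerm β 5) (ex 6 (land (adj 5 6) (preTerm (!β) 6))))))
    (count 5 (neg (uncoloredTerm 5)))

/-- Some literal and its negation imply each other. -/
def inconsistentTerm : Term :=
  ex 5 (land (entry (litTerm 5 false) (litTerm 5 true)) (entry (litTerm 5 true) (litTerm 5 false)))

/-- Test all pairs of a centre and its partner. -/
def search : Stmt :=
  .forRange 0 0 (.forRange 0 1 (.seq (fill impliesTerm) (.seq close
    (.assign 5 (by decide) (.const 0)
      (lor (.read 5 (by decide) (.const 0)) (land balancedTerm (neg inconsistentTerm)))))))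

/-- The memory holds the graph `G` and the vertices `r` and `b`. -/
structure Holding {n : ℕ} (G : SimpleGraph (Fin n)) (r b : Fin n) (s : Memory) : Prop where
  size : s 0 0 = n
  dim : s 0 1 = n + n
  matrix : s 1 = input G 1
  centre : s 2 0 = r
  partner : s 2 1 = b

/-! ### The formulas express the combinatorial conditions -/

variable {n : ℕ} {G : SimpleGraph (Fin n)} {r b : Fin n} {s : Memory}

theorem Holding.write_var (h : Holding G r b s) {x : ℕ} (hx : 1 < x) (k : ℕ) :
    Holding G r b (s.write 2 x k) := by
  obtain ⟨h1, h2, h3, h4, h5⟩ := h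
  refine ⟨?_, ?_, ?_, ?_, ?_⟩
  · rwa [Memory.write_of_ne _ _ _ (by decide)]
  · rwa [Memory.write_of_ne _ _ _ (by decide)]
  · rwa [Memory.write_of_ne _ _ _ (by decide)]
  · rwa [Memory.write_apply, if_neg (by omega)]
  · rwa [Memory.write_apply, if_neg (by omega)]

theorem Holding.congr (h : Holding G r b s) {s' : Memory} (hs : SameInput s s') :
    Holding G r b s' := by
  obtain ⟨h1, h2, h3, h4, h5⟩ := h
  obtain ⟨e1, e2, e3, e4, -⟩ := hs
  exact ⟨by rw [e1, h1], by rw [e1, h2], by rw [e2, h3], by rw [e3, h4], by rw [e4, h5]⟩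

theorem Holding.adj (h : Holding G r b s) {x y : ℕ} {v w : Fin n} (hx : x ≠ 30)
    (hv : s 2 x = v) (hw : s 2 y = w) : (adj x y).Holds s ↔ G.Adj v w := by
  have e : (Term.add (.sum 0 30 (var x)) (var y)).eval s = n * v + w := by
    simp [eval, Memory.write_apply, hx, hv, hw, h.size]
  rw [Holds, RAM.adj, eval, e, h.matrix]
  simp only [input, one_ne_zero, if_false, if_true]
  have : (∃ i j : Fin n, n * (v : ℕ) + w = i * n + j ∧ G.Adj i j) ↔ G.Adj v w := by
    constructor
    · rintro ⟨i, j, hij, hG⟩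
      rw [mul_comm (i : ℕ), index_inj j.2 w.2] at hij
      rwa [Fin.ext hij.1, Fin.ext hij.2]
    · exact fun hG => ⟨v, w, by rw [mul_comm], hG⟩
  simp [this]

theorem holds_eq_var {x y : ℕ} {v w : Fin n}
    (hv : s 2 x = v) (hw : s 2 y = w) : (eq (var x) (var y)).Holds s ↔ v = w := by
  rw [holds_eq, eval_var, eval_var, hv, hw, Fin.ext_iff]

theorem Holding.preTerm (h : Holding G r b s) (β : Bool) {x : ℕ} {v : Fin n} (hx : x ≠ 30)
    (hv : s 2 x = v) : (preTerm β x).Holds s ↔ starPre G r b β v := by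
  cases β <;> simp only [RAM.preTerm, starPre, holds_land, holds_neg, holds_lor,
    holds_eq_var hv h.centre, holds_eq_var hv h.partner, h.adj hx hv h.centre, h.adj hx hv h.partner, Ne]

theorem Holding.uncoloredTerm (h : Holding G r b s) {x : ℕ} {v : Fin n} (hx : x ≠ 30)
    (hv : s 2 x = v) : (uncoloredTerm x).Holds s ↔ Uncolored (starPre G r b) v := by
  simp only [RAM.uncoloredTerm, holds_land, holds_neg, h.preTerm _ hx hv, Uncolored]

theorem Holding.excludedTerm (h : Holding G r b s) (β : Bool) {x : ℕ} {v : Fin n} (hx : x ≠ 30)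
    (hx7 : x ≠ 7) (hv : s 2 x = v) :
    (excludedTerm x β).Holds s ↔ Excluded G (starPre G r b) v β := by
  classical
  -- Unique existence is tested by counting the witnesses.
  have hc := eval_count h.size 7 (land (RAM.adj x 7) (RAM.preTerm (!β) 7))
    (fun z => G.Adj v z ∧ starPre G r b (!β) z) (fun k => by
      have hk := h.write_var (x := 7) (by decide) k
      have h7 : (s.write 2 7 k) 2 7 = k := by simp [Memory.write_apply]
      rw [holds_land, hk.preTerm _ (by decide) h7,
        hk.adj hx (v := v) (by simp [Memory.write_apply, hx7, hv]) h7])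
  simp only [RAM.excludedTerm, holds_lor, holds_land, holds_neg, holds_eq, h.preTerm _ hx hv,
    h.uncoloredTerm hx hv, hc, Excluded, eval, Fintype.existsUnique_iff_card_one]

theorem Holding.conflictTerm (h : Holding G r b s) (β γ : Bool) {v w : Fin n}
    (hv : s 2 5 = v) (hw : s 2 6 = w) :
    (conflictTerm β γ).Holds s ↔ Conflict G (starPre G r b) v β w γ := by
  have hex : (ex 7 (land (RAM.adj 7 5) (land (RAM.adj 7 6) (RAM.preTerm (!β) 7)))).Holds s ↔
      ∃ z, G.Adj z v ∧ G.Adj z w ∧ starPre G r b (!β) z := by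
    rw [holds_ex h.size]
    refine exists_congr fun k => ?_
    have hk := h.write_var (x := 7) (by decide) k
    have h7 : (s.write 2 7 k) 2 7 = k := by simp [Memory.write_apply]
    rw [holds_land, holds_land, hk.preTerm _ (by decide) h7,
      hk.adj (by decide) h7 (w := v) (by simp [Memory.write_apply, hv]),
      hk.adj (by decide) h7 (w := w) (by simp [Memory.write_apply, hw])]
  unfold RAM.conflictTerm Conflict
  split_ifs with hβ
  · simp only [holds_lor, holds_land, holds_neg, hex, holds_eq_var hv hw,
      h.excludedTerm β (by decide) (by decide) hv]
    tauto
  · simp only [holds_land, h.uncoloredTerm (by decide) hv, h.uncoloredTerm (by decide) hw,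
      h.adj (by decide) hv hw]
    tauto

/-- The number of a literal. -/
def litCode (v : Fin n) (β : Bool) : ℕ := v + v + β.toNat

theorem litCode_lt (v : Fin n) (β : Bool) : litCode v β < n + n := by
  have := v.2
  cases β <;> simp [litCode] <;> omega

theorem litCode_inj {v w : Fin n} {β γ : Bool} (h : litCode v β = litCode w γ) :
    v = w ∧ β = γ := by
  rw [Fin.ext_iff]
  cases β <;> cases γ <;> simp [litCode] at h ⊢ <;> omega

theorem exists_litCode {i : ℕ} (hi : i < n + n) : ∃ (v : Fin n) (β : Bool), litCode v β = i := by
  refine ⟨⟨i / 2, by omega⟩, decide (i % 2 = 1), ?_⟩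
  by_cases h : i % 2 = 1 <;> simp [litCode, h] <;> omega

/-- Implication between literals, in terms of their numbers. -/
def CodeImplies (G : SimpleGraph (Fin n)) (r b : Fin n) (i j : ℕ) : Prop :=
  ∃ v w β γ, i = litCode v β ∧ j = litCode w γ ∧ Conflict G (starPre G r b) v β w (!γ)

theorem codeImplies_litCode {v w : Fin n} {β γ : Bool} :
    CodeImplies G r b (litCode v β) (litCode w γ) ↔
      Conflict G (starPre G r b) v β w (!γ) := by
  constructor
  · rintro ⟨v', w', β', γ', h1, h2, h⟩
    obtain ⟨rfl, rfl⟩ := litCode_inj h1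
    obtain ⟨rfl, rfl⟩ := litCode_inj h2
    exact h
  · exact fun h => ⟨v, w, β, γ, rfl, rfl, h⟩

theorem eval_litTerm {x : ℕ} {v : Fin n} (hv : s 2 x = v)
    (β : Bool) : (litTerm x β).eval s = litCode v β := by
  simp [litTerm, eval, litCode, hv]

theorem Holding.impliesTerm (h : Holding G r b s) :
    impliesTerm.Holds s ↔ CodeImplies G r b (s 2 2) (s 2 3) := by
  unfold RAM.impliesTerm CodeImplies
  rw [holds_ex h.size]
  refine exists_congr fun v => ?_
  have hv := h.write_var (x := 5) (by decide) v
  rw [holds_ex hv.size]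
  refine exists_congr fun w => ?_
  have hw := hv.write_var (x := 6) (by decide) w
  have h5 : ((s.write 2 5 v).write 2 6 w) 2 5 = v := by simp [Memory.write_apply]
  have h6 : ((s.write 2 5 v).write 2 6 w) 2 6 = w := by simp [Memory.write_apply]
  simp only [holds_anyBool, holds_land, holds_eq, eval_litTerm h5, eval_litTerm h6,
    hw.conflictTerm _ _ h5 h6]
  simp [Memory.write_apply]

theorem Holding.balancedTerm (h : Holding G r b s) :
    balancedTerm.Holds s ↔ Balanced G (starPre G r b) := by
  classical
  have h5 : ∀ k : ℕ, (s.write 2 5 k) 2 5 = k := fun k => by simp [Memory.write_apply]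
  have e1 := eval_count h.size 5 (RAM.uncoloredTerm 5) (Uncolored (starPre G r b)) fun k =>
    (h.write_var (by decide) k).uncoloredTerm (by decide) (h5 k)
  have e2 := eval_count h.size 5 (neg (RAM.uncoloredTerm 5))
    (fun z => ¬ Uncolored (starPre G r b) z) fun k => by
      rw [holds_neg, (h.write_var (by decide) k).uncoloredTerm (by decide) (h5 k)]
  have e3 := eval_count h.size 5
    (anyBool fun β => land (RAM.preTerm β 5) (ex 6 (land (RAM.adj 5 6) (RAM.preTerm (!β) 6))))
    (Saturated G (starPre G r b)) fun k => by
      have hk := h.write_var (x := 5) (by decide) k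
      rw [holds_anyBool]
      refine exists_congr fun β => ?_
      rw [holds_land, hk.preTerm _ (by decide) (h5 k), holds_ex hk.size]
      refine and_congr_right fun _ => exists_congr fun y => ?_
      have hy := hk.write_var (x := 6) (by decide) y
      have h6 : ((s.write 2 5 k).write 2 6 y) 2 6 = y := by simp [Memory.write_apply]
      rw [holds_land, hy.adj (by decide) (v := k) (by simp [Memory.write_apply]) h6,
        hy.preTerm _ (by decide) h6]
  rw [RAM.balancedTerm, holds_eq, eval, e1, e2, e3, Balanced]

theorem holds_entry_litTerm {x : ℕ} {v : Fin n} (hx : x ≠ 30)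
    (hv : s 2 x = v) (β γ : Bool) :
    (entry (litTerm x β) (litTerm x γ)).Holds s ↔ s.Rel (litCode v β) (litCode v γ) := by
  have : (index (litTerm x β) (litTerm x γ)).eval s = s 0 1 * litCode v β + litCode v γ := by
    simp [index, eval, litTerm, litCode, Memory.write_apply, hx, hv]
  rw [Holds, entry, eval, this, Memory.Rel]

theorem Holding.inconsistentTerm (h : Holding G r b s) :
    inconsistentTerm.Holds s ↔ ∃ v : Fin n, s.Rel (litCode v false) (litCode v true) ∧
      s.Rel (litCode v true) (litCode v false) := by
  rw [RAM.inconsistentTerm, holds_ex h.size]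
  refine exists_congr fun k => ?_
  have hk := h.write_var (x := 5) (by decide) k
  have h5 : (s.write 2 5 k) 2 5 = k := by simp [Memory.write_apply]
  rw [holds_land, holds_entry_litTerm (by decide) h5, holds_entry_litTerm (by decide) h5,
    Memory.rel_write_var, Memory.rel_write_var]

/-- Symmetry of `Conflict` makes the implication relation closed under contraposition, and
minimality passes this on to its closure; `exists_assignment` then yields a colouring. Conversely, a
colouring respecting the conflicts preserves truth along the closure, so no literal is equivalent to
its negation. -/
theorem Holding.consistent_iff (h : Holding G r b s) :
    SameInput s (close.run ((fill RAM.impliesTerm).run s)) ∧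
    (¬ RAM.inconsistentTerm.Holds (close.run ((fill RAM.impliesTerm).run s)) ↔
      ∃ c, RespectsConflicts G (starPre G r b) c) := by
  obtain ⟨h1, h2⟩ := fill_spec RAM.impliesTerm s (CodeImplies G r b) fun s' hs' =>
    (h.congr hs').impliesTerm
  set s1 := (fill RAM.impliesTerm).run s
  obtain ⟨h3, hE, htr, hmin⟩ := close_spec s1 (E := CodeImplies G r b) (by rwa [h1.1])
  set s2 := close.run s1
  have hs2 := h1.trans h3
  refine ⟨hs2, ?_⟩
  rw [(h.congr hs2).inconsistentTerm]
  rw [show s1 0 1 = n + n from (h.congr h1).dim] at *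
  constructor
  · intro hcons
    push Not at hcons
    obtain ⟨c, hc⟩ := exists_assignment
      (S := fun l m : Fin n × Bool => s2.Rel (litCode l.1 l.2) (litCode m.1 m.2))
      (fun l m k => htr _ _ _ (litCode_lt _ _) (litCode_lt _ _) (litCode_lt _ _))
      (by
        rintro ⟨v, β⟩ ⟨w, γ⟩ hvw
        -- The relation compared with the closure is its own contrapositive: it contains the
        -- generating implications and is transitive.
        refine hmin (fun i j => ∀ (v w : Fin n) (β γ : Bool), litCode v β = i → litCode w γ = j →
          s2.Rel (litCode w !γ) (litCode v !β)) ?_ ?_ _ _ (litCode_lt _ _) (litCode_lt _ _) hvw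
          v w β γ rfl rfl
        · rintro i j - - hij v w β γ rfl rfl
          refine hE _ _ (litCode_lt _ _) (litCode_lt _ _) ?_
          rw [codeImplies_litCode] at hij ⊢
          rw [Bool.not_not]
          exact hij.symm
        · rintro i j k - hj - hij hjk v w β γ rfl rfl
          obtain ⟨u, δ, rfl⟩ := exists_litCode hj
          exact htr _ _ _ (litCode_lt _ _) (litCode_lt _ _) (litCode_lt _ _)
            (hjk _ _ _ _ rfl rfl) (hij _ _ _ _ rfl rfl))
      (fun v hv => hcons v hv.1 hv.2)
    refine ⟨c, fun v w hvw => ?_⟩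
    have := hc (v, c v) (w, !c w) (hE _ _ (litCode_lt _ _) (litCode_lt _ _) (by
      rw [codeImplies_litCode, Bool.not_not]
      exact hvw)) rfl
    cases h : c w <;> simp [h] at this
  · rintro ⟨c, hc⟩ ⟨v, hv1, hv2⟩
    -- Here the comparison relation is preservation of truth under `c`.
    have key := hmin (fun i j => ∀ (v w : Fin n) (β γ : Bool), litCode v β = i →
      litCode w γ = j → c v = β → c w = γ) (by
        rintro i j - - hij v w β γ rfl rfl hv
        rw [codeImplies_litCode] at hij
        by_contra hne
        refine hc v w ?_
        rw [hv]
        convert hij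
        exact (Bool.not_eq.2 (Ne.symm hne)).symm) (by
        rintro i j k - hj - hij hjk v w β γ rfl rfl hv
        obtain ⟨u, δ, rfl⟩ := exists_litCode hj
        exact hjk _ _ _ _ rfl rfl (hij _ _ _ _ rfl rfl hv))
    have k1 := key _ _ (litCode_lt _ _) (litCode_lt _ _) hv1 v v _ _ rfl rfl
    have k2 := key _ _ (litCode_lt _ _) (litCode_lt _ _) hv2 v v _ _ rfl rfl
    cases h : c v
    · exact Bool.false_ne_true (h.symm.trans (k1 h))
    · exact Bool.false_ne_true ((k2 h).symm.trans h)

theorem search_spec (G : SimpleGraph (Fin n)) {s : Memory} (h0 : s 0 0 = n) (h1 : s 0 1 = n + n)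
    (hG : s 1 = input G 1) (h5 : s 5 0 = 0) :
    search.run s 5 0 ≠ 0 ↔ ∃ r b, Balanced G (starPre G r b) ∧
      ∃ c, RespectsConflicts G (starPre G r b) c := by
  set Acc : Fin n → Fin n → Prop := fun r b => Balanced G (starPre G r b) ∧
      ∃ c, RespectsConflicts G (starPre G r b) c
  have houter := Stmt.run_forRange_induction (c := 0) (x := 0)
    (p := .forRange 0 1 (.seq (fill impliesTerm) (.seq close
    (.assign 5 (by decide) (.const 0)
      (lor (.read 5 (by decide) (.const 0)) (land balancedTerm (neg inconsistentTerm)))))))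
    (s := s) (fun k s' => s' 0 = s 0 ∧ s' 1 = s 1 ∧
      (s' 5 0 ≠ 0 ↔ ∃ r b : Fin n, (r : ℕ) < k ∧ Acc r b))
    ⟨rfl, rfl, by simp [h5]⟩ (by
    rintro k s' hk ⟨e0, e1, h5'⟩
    rw [h0] at hk
    have e0' : (s'.write 2 0 k) 0 = s 0 := by rw [Memory.write_of_ne _ _ _ (by decide), e0]
    have := Stmt.run_forRange_induction (c := 0) (x := 1)
      (p := .seq (fill impliesTerm) (.seq close (.assign 5 (by decide) (.const 0)
        (lor (.read 5 (by decide) (.const 0)) (land balancedTerm (neg inconsistentTerm))))))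
      -- Pairs are tested in lexicographic order; cell `0` of array `5` is non-zero once some tested
      -- pair is accepted.
      (s := s'.write 2 0 k) (fun l s'' => s'' 0 = s 0 ∧ s'' 1 = s 1 ∧ s'' 2 0 = k ∧
        (s'' 5 0 ≠ 0 ↔ ∃ r b : Fin n, ((r : ℕ) < k ∨ (r : ℕ) = k ∧ (b : ℕ) < l) ∧ Acc r b))
      ⟨e0', by rw [Memory.write_of_ne _ _ _ (by decide), e1], by simp [Memory.write_apply], by
        rw [Memory.write_of_ne _ _ _ (by decide)]
        simpa using h5'⟩ (by
      rintro l s2 hl ⟨e0, e1, hk2, h5''⟩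
      rw [e0', h0] at hl
      have hold : Holding G ⟨k, hk⟩ ⟨l, hl⟩ (s2.write 2 1 l) := by
        refine ⟨?_, ?_, ?_, ?_, ?_⟩
        · rw [Memory.write_of_ne _ _ _ (by decide), e0, h0]
        · rw [Memory.write_of_ne _ _ _ (by decide), e0, h1]
        · rw [Memory.write_of_ne _ _ _ (by decide), e1, hG]
        · simp [Memory.write_apply, hk2]
        · simp [Memory.write_apply]
      obtain ⟨hs, hcons⟩ := hold.consistent_iff
      have hold' := hold.congr hs
      simp only [Stmt.run]
      set s3 := close.run ((fill RAM.impliesTerm).run (s2.write 2 1 l))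
      refine ⟨?_, ?_, ?_, ?_⟩
      · rw [Memory.write_of_ne _ _ _ (by decide), hs.1, Memory.write_of_ne _ _ _ (by decide), e0]
      · rw [Memory.write_of_ne _ _ _ (by decide), hs.2.1, Memory.write_of_ne _ _ _ (by decide), e1]
      · rw [Memory.write_of_ne _ _ _ (by decide), hold'.centre]
      · rw [Memory.write_apply, if_pos ⟨rfl, rfl⟩]
        change Term.Holds _ _ ↔ _
        have e5 : (Term.read 5 (by decide) (.const 0)).Holds s3 ↔ s2 5 0 ≠ 0 := by
          rw [Holds, eval, eval, hs.2.2.2.2, Memory.write_of_ne _ _ _ (by decide)]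
        rw [holds_lor, e5, h5'', holds_land, holds_neg, hold'.balancedTerm, hcons]
        constructor
        · rintro (⟨r, b, hrb, hA⟩ | hA)
          · exact ⟨r, b, by omega, hA⟩
          · exact ⟨⟨k, hk⟩, ⟨l, hl⟩, .inr ⟨rfl, Nat.lt_succ_self l⟩, hA⟩
        · rintro ⟨r, b, hrb, hA⟩
          by_cases hkl : (r : ℕ) = k ∧ (b : ℕ) = l
          · right
            obtain ⟨rfl, rfl⟩ := hkl
            exact hA
          · exact .inl ⟨r, b, by omega, hA⟩)
    rw [e0', h0] at this
    refine ⟨this.1, this.2.1, this.2.2.2.trans (exists_congr fun r => exists_congr fun b => ?_)⟩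
    have := b.2
    exact and_congr_left fun _ => by omega)
  refine houter.2.2.trans (exists_congr fun r => exists_congr fun b => ?_)
  rw [h0]
  exact and_iff_right r.2

end RAM

/-! ### The complete program and its polynomial bound -/

open RAM in
/-- Perfect Matching Cut can be solved in polynomial time on graphs of radius at most `2`. -/
theorem polyTimeSolvableOn_radius_le_two :
    PolyTimeSolvableOn (fun _ G => HasPerfectMatchingCut G) (fun _ G => G.radius ≤ 2) := by
  obtain ⟨p, f, hp⟩ := search.exists_program 0
  -- The number of literals, twice `n`, must be stored before `search` starts, as statements cannot
  -- write to array `0`. The flag in array `5` may be any positive number and is normalised to `1`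
  -- at the end. All cells of array `0` are at most twice `n` during the search, hence the
  -- composition with `X + X`; the two outer writes cost 7 and 8 steps.
  refine ⟨.seq (.write 0 (.const 1) (.add (.read 0 (.const 0)) (.read 0 (.const 0))))
    (.seq p (.write 0 (.const 0) (.sub (.const 1) (.sub (.const 1) (.read 5 (.const 0)))))),
    f.comp (Polynomial.X + Polynomial.X) + 15, fun n G hG => ?_⟩
  change G.radius ≤ 2 at hG
  have hne : Nonempty (Fin n) := by
    by_contra h
    rw [not_nonempty_iff] at h
    rw [SimpleGraph.radius_eq_top_of_isEmpty] at hG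
    simp at hG
  have hin : ((input G).write 0 1 (n + n)) 0 0 = n := by simp [Memory.write_apply, input]
  obtain ⟨τ, s', hx, hτ, hs, -⟩ := hp ((input G).write 0 1 (n + n))
    ((input G).write 0 1 (n + n)) (n + n) (by
      intro c
      simp only [Memory.write_apply, input, true_and, if_true]
      split_ifs <;> omega) (AgreeTo.refl _ _)
  have hans := search_spec G hin (by simp [Memory.write_apply])
    (Memory.write_of_ne _ _ _ (by decide)) (by simp [Memory.write_apply, input])
  rw [← exists_isCutColoring_iff hG, ← hasPerfectMatchingCut_iff, ← hs.1 5 (by decide)] at hans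
  refine ⟨_, _, .seq (.write _ _ _ _) (.seq (by simpa [Expr.eval, input] using hx)
    (.write _ _ _ _)), ?_, fun hQ => ?_, fun hQ => ?_⟩
  · simp only [Expr.cost, Polynomial.eval_add, Polynomial.eval_comp, Polynomial.eval_X,
      Polynomial.eval_ofNat]
    omega
  · have := hans.2 hQ
    simp only [Memory.write_apply, Expr.eval, and_self, if_true]
    omega
  · have := mt hans.1 hQ
    simp only [Memory.write_apply, Expr.eval, and_self, if_true]
    omega

end PMC

/-- Perfect Matching Cut is polynomial-time solvable for graphs of radius at most `2`. (A graph
with finite radius is non-empty and connected.) -/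
theorem theorem4p8 :
    PMC.PolyTimeSolvableOn
      (fun _ G => PMC.HasPerfectMatchingCut G)
      (fun _ G => G.radius ≤ 2) := by
  exact PMC.polyTimeSolvableOn_radius_le_two
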